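/- **Conventions.** Symmetric functions are taken with complex coefficients, in variables $x_1,x_2,\dots$; $p_k,h_k,e_k$ are the power sum, complete homogeneous and elementary symmetric functions ($h_0=e_0=1$, $e_k=0$ for $k<0$), and $s_\lambda=\det(e_{\lambda^t_i-i+j})_{1\le i,j\le\lambda_1}$ is the Schur function of the partition $\lambda$ ($\lambda^t$ is the conjugate partition, $\lambda_1$ the largest part of $\lambda$, with $\lambda_1=0$ for the empty partition). The plethysm $f[g]$ is the algebra homomorphism in $f$ determined by $p_k[g]=g(x_1^k,x_2^k,\dots)$. For a class function $\chi$ on $S_n$, its Frobenius image is $\operatorname{ch}(\chi)=\frac1{n!}\sum_{w\in S_n}\chi(w)\,p_{\lambda(w)}$, where $\lambda(w)$ is the cycle type of $w$; $\operatorname{ch}$ is a bijection onto the symmetric functions that are homogeneous of degree $n$, and the irreducible character $\chi^\lambda$ is the one with $\operatorname{ch}(\chi^\lambda)=s_\lambda$. A symmetric function $f=\sum_\lambda c_\lambda s_\lambda$ (a class function $\chi=\sum_\lambda c_\lambda\chi^\lambda$) is *bounded by* $N$ if $\lambda_1\le N$ whenever $c_\lambda\ne0$ in this unique expansion, and *sharply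 bounded by* $N$ if $N$ is the smallest such number. Let $\mathrm{Lie}_{(n)}$ be the character of $S_n$ induced from the linear character of the cyclic group generated by an $n$-cycle $c$ that sends $c$ to the primitive $n$-th root of unity $e^{2\pi i/n}$. Put $\ell_n=\operatorname{ch}(\mathrm{Lie}_{(n)})$ and $\pi_n=\operatorname{ch}(\epsilon\otimes\mathrm{Lie}_{(n)})$, where $\epsilon$ is the sign character. For a partition $\lambda=1^{m_1}2^{m_2}\cdots$ of $n$, let $\mathrm{Lie}_\lambda$ and $W_\lambda$ be the characters of $S_n$ with $$\operatorname{ch}(\mathrm{Lie}_\lambda)=\prod_{j\ge1}h_{m_j}[\ell_j],\qquad \operatorname{ch}(W_\lambda)=\prod_{j\text{ odd}}h_{m_j}[\pi_j]\prod_{j\text{ even}}e_{m_j}[\pi_j],$$ and let $\operatorname{rank}(\lambda)=\sum_j (j-1)m_j$. Let $\widehat{\mathrm{Lie}}^i=\bigoplus_\lambda \mathrm{Lie}_\lambda$ and $\widehat W^i=\bigoplus_\lambda W_\lambda$, over all partitions $\lambda$ (of any size) with $\operatorname{rank}(\lambda)=i$ and no parts of size $1$. **Theorem.** (a) For $m\ge1$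 and $n\ge3$, all of $h_m[\ell_n]$, $h_m[\pi_n]$, $e_m[\ell_n]$, $e_m[\pi_n]$ are bounded by $m(n-1)$. (b) For $m\ge1$, $h_m[\ell_2]$ is sharply bounded by $m$. (c) For $m\ge1$, $e_m[\pi_2]$ is sharply bounded by $m+1$. (d) If $\lambda$ has no parts of size $1$ and $\operatorname{rank}(\lambda)=i$, then $\mathrm{Lie}_\lambda$ is bounded by $i$ and $W_\lambda$ is bounded by $i+1$. (e) Hence, for every $i\ge0$, $\widehat{\mathrm{Lie}}^i$ and $\widehat W^i$ are bounded by $i$ and $i+1$ respectively. Writing $\widehat{\mathrm{Lie}}^i$, respectively $\widehat W^i$, as $\sum_\mu c_\mu\chi^\mu$, the number $\max\{|\mu|+\mu_1 : c_\mu\neq0\}$ equals $3i$ for $\widehat{\mathrm{Lie}}^i$ (for every $i\ge0$), respectively $3i+1$ for $\widehat W^i$ (for every $i\ge1$). -/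

import Mathlib

noncomputable section

namespace SymmFun

open Equiv

/-! ### Symmetric functions, as power series in `x_0, x_1, x_2, …` over `ℂ` -/

/-- The power sum `p_k = ∑ x_i ^ k` (used for `k ≥ 1`). -/
def psum (k : ℕ) : MvPowerSeries ℕ ℂ := by
  classical
  exact fun a => if ∃ i, a = Finsupp.single i k then 1 else 0

/-- The complete homogeneous symmetric function `h_d`: the sum of all monomials of degree `d`. -/
def hsymm (d : ℕ) : MvPowerSeries ℕ ℂ :=
  fun a => if a.degree = d then 1 else 0

/-- The elementary symmetric function `e_d`: the sum of all squarefree monomials of degree `d`. -/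
def esymm (d : ℕ) : MvPowerSeries ℕ ℂ := by
  classical
  exact fun a => if a.degree = d ∧ ∀ i, a i ≤ 1 then 1 else 0

/-- `e_k` for an integer index, with `e_k = 0` for `k < 0`. -/
def esymmInt (k : ℤ) : MvPowerSeries ℕ ℂ :=
  if k < 0 then 0 else esymm k.toNat

/-- The largest part `λ₁` of a partition (`0` for the empty partition). -/
def firstPart {n : ℕ} (lam : n.Partition) : ℕ := lam.parts.sup

/-- The parts of the conjugate partition, indexed from zero: `conjPart lam j` is the length of
the `(j + 1)`-st column of the Ferrers diagram of `lam`. -/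
def conjPart {n : ℕ} (lam : n.Partition) (j : ℕ) : ℕ :=
  (lam.parts.filter fun p => j < p).card

/-- The Schur function `s_λ = det (e_{λᵗ_i - i + j})`, `1 ≤ i, j ≤ λ₁`. -/
def schur {n : ℕ} (lam : n.Partition) : MvPowerSeries ℕ ℂ :=
  (Matrix.of fun i j : Fin (firstPart lam) =>
    esymmInt ((conjPart lam i : ℤ) - (i : ℤ) + (j : ℤ))).det

/-- The algebra homomorphism `F ↦ F(p_1, p_2, …)`; the variable with index `k` goes to
`p_{k+1}`. -/
def evalPsum : MvPolynomial ℕ ℂ →ₐ[ℂ] MvPowerSeries ℕ ℂ :=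
  MvPolynomial.aeval fun k => psum (k + 1)

/-- The plethysm `f[g]` for a symmetric function `f`: it is an algebra homomorphism in `f`, and
`p_k[g] = g(x_0 ^ k, x_1 ^ k, …)`. So `f` is written (uniquely) as a polynomial in the power
sums, and each `p_k` is replaced by `g(x_0 ^ k, x_1 ^ k, …)`. -/
def plethysm (f g : MvPowerSeries ℕ ℂ) : MvPowerSeries ℕ ℂ :=
  MvPolynomial.aeval (fun k => MvPowerSeries.expand (k + 1) k.succ_ne_zero g)
    (Function.invFun evalPsum f)

/-- A finite linear combination of Schur functions (of possibly different degrees). -/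
def schurSum (c : (Σ n : ℕ, n.Partition) →₀ ℂ) : MvPowerSeries ℕ ℂ :=
  c.sum fun lam a => a • schur lam.2

/-- `c` is the unique family of coefficients with `f = ∑ c_λ s_λ`. -/
def IsSchurExpansion (f : MvPowerSeries ℕ ℂ) (c : (Σ n : ℕ, n.Partition) →₀ ℂ) : Prop :=
  ∀ c', schurSum c' = f ↔ c' = c

/-- `f` is bounded by `N`: it has a unique Schur expansion `f = ∑ c_λ s_λ`, in which `λ₁ ≤ N`
whenever `c_λ ≠ 0`. -/
def BoundedBy (f : MvPowerSeries ℕ ℂ) (N : ℕ) : Prop :=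
  ∃ c, IsSchurExpansion f c ∧ ∀ lam, c lam ≠ 0 → firstPart lam.2 ≤ N

/-- `N` is the smallest number by which `f` is bounded. -/
def SharplyBoundedBy (f : MvPowerSeries ℕ ℂ) (N : ℕ) : Prop :=
  IsLeast {M : ℕ | BoundedBy f M} N

/-! ### Class functions on symmetric groups -/

/-- The complex class functions on a group. -/
def ClassFun (G : Type) [Group G] : Submodule ℂ (G → ℂ) where
  carrier := {f | ∀ g w, f (g * w * g⁻¹) = f w}
  add_mem' hf hf' g w := by simp only [Pi.add_apply, hf g w, hf' g w]
  zero_mem' _ _ := rfl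
  smul_mem' a f hf g w := by simp only [Pi.smul_apply, hf g w]

/-- The class function on `G` induced from a class function `f` on a subgroup `H`:
`w ↦ |H|⁻¹ ∑ f (x⁻¹ w x)`, the sum being over the `x ∈ G` with `x⁻¹ w x ∈ H`. -/
def induce {G : Type} [Group G] [Fintype G] (H : Subgroup G) (f : ClassFun H) : ClassFun G := by
  classical
  exact ⟨fun w => (Nat.card H : ℂ)⁻¹ *
      ∑ x : G, if hx : x⁻¹ * w * x ∈ H then f.1 ⟨x⁻¹ * w * x, hx⟩ else 0, by
    intro g w
    dsimp only
    congr 1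
    refine Fintype.sum_equiv (Equiv.mulLeft g⁻¹) _ _ fun x => ?_
    have h : x⁻¹ * (g * w * g⁻¹) * x = (g⁻¹ * x)⁻¹ * w * (g⁻¹ * x) := by group
    rw [Equiv.coe_mulLeft]
    have key : ∀ y z : G, y = z →
        (if hy : y ∈ H then f.1 ⟨y, hy⟩ else 0) = if hz : z ∈ H then f.1 ⟨z, hz⟩ else 0 := by
      rintro y _ rfl
      rfl
    exact key _ _ h⟩

/-- The twist `ε ⊗ χ` of a class function on `S_n` by the sign character. -/
def signTwist {n : ℕ} (f : ClassFun (Perm (Fin n))) : ClassFun (Perm (Fin n)) :=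
  ⟨fun w => ((Perm.sign w : ℤ) : ℂ) * f.1 w, by
    intro g w
    have h : Perm.sign (g * w * g⁻¹) = Perm.sign w := by
      rw [map_mul, map_mul, mul_right_comm, ← map_mul, mul_inv_cancel, map_one, one_mul]
    dsimp only
    rw [h, f.2 g w]⟩

/-- The Frobenius characteristic `ch f = (1/n!) ∑_w f(w) p_{λ(w)}`, where `λ(w)` is the cycle
type of `w` (fixed points included). -/
def ch {n : ℕ} (f : ClassFun (Perm (Fin n))) : MvPowerSeries ℕ ℂ :=
  ((n.factorial : ℂ)⁻¹) • ∑ w : Perm (Fin n), f.1 w • (w.partition.parts.map psum).prod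

/-- The class function on `S_n` with a given Frobenius characteristic; `ch` is a bijection from
the class functions on `S_n` to the symmetric functions that are homogeneous of degree `n`. -/
def chInv (n : ℕ) (F : MvPowerSeries ℕ ℂ) : ClassFun (Perm (Fin n)) :=
  Function.invFun ch F

/-- The irreducible character `χ^λ` of `S_n`, the one with `ch (χ^λ) = s_λ`. -/
def irrChar {n : ℕ} (lam : n.Partition) : ClassFun (Perm (Fin n)) := chInv n (schur lam)

/-- `c` is the unique family of coefficients with `χ = ∑ c_λ χ^λ`. -/
def IsIrrExpansion {n : ℕ} (χ : ClassFun (Perm (Fin n))) (c : n.Partition → ℂ) : Prop :=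
  ∀ c' : n.Partition → ℂ, ∑ lam, c' lam • irrChar lam = χ ↔ c' = c

/-- `χ` is bounded by `N`: in its unique expansion `χ = ∑ c_λ χ^λ`, one has `λ₁ ≤ N` whenever
`c_λ ≠ 0`. -/
def CharBoundedBy {n : ℕ} (χ : ClassFun (Perm (Fin n))) (N : ℕ) : Prop :=
  ∃ c, IsIrrExpansion χ c ∧ ∀ lam, c lam ≠ 0 → firstPart lam ≤ N

/-! ### Lie characters and Whitney homology characters -/

/-- The complex number `exp (2πi/n)`, a primitive `n`-th root of unity for `n ≥ 1`. -/
def rootUnit (n : ℕ) : ℂˣ :=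
  Units.mk0 (Complex.exp (2 * Real.pi * Complex.I / n)) (Complex.exp_ne_zero _)

lemma orderOf_rootUnit_dvd (n : ℕ) :
    orderOf (rootUnit n) ∣
      orderOf (⟨finRotate n, Subgroup.mem_zpowers _⟩ : Subgroup.zpowers (finRotate n)) := by
  rw [Subgroup.orderOf_mk]
  rcases n with _ | _ | n
  · have : rootUnit 0 = 1 := by ext; simp [rootUnit]
    simp [this]
  · have : rootUnit 1 = 1 := by ext; simp [rootUnit]
    simp [this]
  · rw [isCycle_finRotate.orderOf, support_finRotate, Finset.card_univ, Fintype.card_fin]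
    apply orderOf_dvd_of_pow_eq_one
    ext
    exact (Complex.isPrimitiveRoot_exp (n + 2) (by omega)).pow_eq_one

/-- The linear character of the cyclic group `C_n` generated by the `n`-cycle `finRotate n`
that sends this `n`-cycle to `exp (2πi/n)`. -/
def cyclicHom (n : ℕ) : Subgroup.zpowers (finRotate n) →* ℂˣ :=
  monoidHomOfForallMemZpowers
    (g := (⟨finRotate n, Subgroup.mem_zpowers _⟩ : Subgroup.zpowers (finRotate n)))
    (by rintro ⟨_, k, rfl⟩; exact ⟨k, rfl⟩) (orderOf_rootUnit_dvd n)

/-- A linear character as a class function. -/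
def linChar {G : Type} [Group G] (χ : G →* ℂˣ) : ClassFun G :=
  ⟨fun w => χ w, by
    intro g w
    simp⟩

/-- The Lie character `Lie_(n)` of `S_n`, induced from the cyclic group `C_n`. -/
def lieCyc (n : ℕ) : ClassFun (Perm (Fin n)) :=
  induce (Subgroup.zpowers (finRotate n)) (linChar (cyclicHom n))

/-- `ℓ_n = ch (Lie_(n))`. -/
def ell (n : ℕ) : MvPowerSeries ℕ ℂ := ch (lieCyc n)

/-- `π_n = ch (ε ⊗ Lie_(n))`. -/
def piSymm (n : ℕ) : MvPowerSeries ℕ ℂ := ch (signTwist (lieCyc n))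

/-- The character `Lie_λ` of `S_n`, with `ch (Lie_λ) = ∏_{j ≥ 1} h_{m_j}[ℓ_j]`, where `m_j` is
the number of parts of `λ` equal to `j`. -/
def lieChar {n : ℕ} (lam : n.Partition) : ClassFun (Perm (Fin n)) :=
  chInv n (∏ j ∈ Finset.Icc 1 n, plethysm (hsymm (lam.parts.count j)) (ell j))

/-- The character `W_λ` of `S_n`, with
`ch (W_λ) = ∏_{j odd} h_{m_j}[π_j] * ∏_{j even} e_{m_j}[π_j]`, where `m_j` is the number of parts
of `λ` equal to `j`. -/
def whitneyChar {n : ℕ} (lam : n.Partition) : ClassFun (Perm (Fin n)) :=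
  chInv n
    ((∏ j ∈ Finset.Icc 1 n with Odd j, plethysm (hsymm (lam.parts.count j)) (piSymm j)) *
      ∏ j ∈ Finset.Icc 1 n with Even j, plethysm (esymm (lam.parts.count j)) (piSymm j))

/-- The rank `∑ (λ_k - 1)` of a partition. -/
def rank {n : ℕ} (lam : n.Partition) : ℕ := (lam.parts.map fun p => p - 1).sum

/-- The partitions of `n` of rank `i` with no parts of size `1`. -/
def derangementTypes (i n : ℕ) : Finset n.Partition :=
  Finset.univ.filter fun lam => 1 ∉ lam.parts ∧ rank lam = i

/-- The degree `n` component of `Lie-hat^i`: the sum of the `Lie_λ` over the partitions `λ` of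
`n` of rank `i` with no parts of size `1`. -/
def lieHat (i n : ℕ) : ClassFun (Perm (Fin n)) := ∑ lam ∈ derangementTypes i n, lieChar lam

/-- The degree `n` component of `W-hat^i`: the sum of the `W_λ` over the partitions `λ` of
`n` of rank `i` with no parts of size `1`. -/
def whitneyHat (i n : ℕ) : ClassFun (Perm (Fin n)) :=
  ∑ lam ∈ derangementTypes i n, whitneyChar lam

/-- The set of all `|μ| + μ₁` with `c_μ ≠ 0`, for coefficients `c` indexed by the partitions `μ`
of all sizes. -/
def stabSet (c : (n : ℕ) → n.Partition → ℂ) : Set ℕ :=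
  {k | ∃ (n : ℕ) (mu : n.Partition), c n mu ≠ 0 ∧ k = n + firstPart mu}

end SymmFun

end

/-! The proof replaces boundedness by a condition on monomials: a symmetric function is bounded by
`N` exactly when no variable occurs in it with exponent above `N` (`boundedBy_of_expLE`,
`BoundedBy.expLE`). Indeed `s_λ` is a signed sum of products of `λ₁` elementary functions, which are
squarefree, so its exponents are at most `λ₁`. Conversely `x^λ`, whose `x_0`-exponent is `λ₁`, has
strictly smallest weight `∑ k a_k` in `s_λ`. Among the shapes with maximal `λ₁` in a combination,
one with smallest weight keeps its leading monomial (`exists_coeff_lead`).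

Exponent bounds add under products and are multiplied by `k` under `x_i ↦ x_i^k`. Newton's recursion
therefore carries a bound `N` for `g` to `m * N` for `h_m[g]` and `e_m[g]`. In degree `n` the
exponent `n` occurs only in `x_i^n`, and its coefficient in `ch χ` is the multiplicity of the
trivial character. By Frobenius reciprocity this vanishes for `ℓ_n` if `n ≥ 2` and for `π_n` if `n ≥
3`, because `ζ ≠ 1` and `±ζ ≠ 1` respectively.

The exception is `π_2 = h_2 = e_2 + p_2`. Here `e_m[h_2] = ∑ e_i[e_2] p_2[e_j]`, and a factor with
`j > 0` contributes 2 to the exponent while `i ≤ m - 1`, so the bound is `m + 1`. Sharpness comes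
from explicit monomials: `x_0^m x_1^m` in `h_m[e_2]` and `x_0^(m+1) x_1 ⋯ x_(m-1)` in `e_m[h_2]`. A
partition of rank `i` without parts 1 has size at most `2i`, with equality only for `2^i`, so these
monomials also attain the maximum of `|μ| + μ₁`.

Independence of the Schur functions and of the power sum products makes the expansions unique and
turns the `invFun` in `plethysm` and `chInv` into true inverses. -/

noncomputable section

namespace SymmFun

open Finset MvPowerSeries

/-! ### Exponent bounds -/

/-- Every monomial of `f` has all its exponents at most `N`. -/
def ExpLE (f : MvPowerSeries ℕ ℂ) (N : ℕ) : Prop :=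
  ∀ a : ℕ →₀ ℕ, coeff a f ≠ 0 → ∀ i, a i ≤ N

lemma ExpLE.mono {f : MvPowerSeries ℕ ℂ} {M N : ℕ} (h : ExpLE f M) (hMN : M ≤ N) : ExpLE f N :=
  fun a ha i => (h a ha i).trans hMN

lemma ExpLE.zero (N : ℕ) : ExpLE 0 N := fun a ha => by simp at ha

lemma ExpLE.one (N : ℕ) : ExpLE 1 N := fun a ha i => by
  rw [coeff_one] at ha
  have : a = 0 := by by_contra h; simp [h] at ha
  simp [this]

lemma ExpLE.add {f g : MvPowerSeries ℕ ℂ} {N : ℕ} (hf : ExpLE f N) (hg : ExpLE g N) :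
    ExpLE (f + g) N := fun a ha i => by
  by_cases h : coeff a f = 0
  · refine hg a (fun h' => ha ?_) i
    rw [map_add, h, h', add_zero]
  · exact hf a h i

lemma ExpLE.smul {f : MvPowerSeries ℕ ℂ} {N : ℕ} (hf : ExpLE f N) (c : ℂ) : ExpLE (c • f) N :=
  fun a ha i => hf a (fun h => ha (by rw [coeff_smul, h, mul_zero])) i

lemma ExpLE.sum {ι : Type*} {s : Finset ι} {f : ι → MvPowerSeries ℕ ℂ} {N : ℕ}
    (h : ∀ i ∈ s, ExpLE (f i) N) : ExpLE (∑ i ∈ s, f i) N :=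
  Finset.sum_induction f (ExpLE · N) (fun _ _ => ExpLE.add) (ExpLE.zero N) h

lemma ExpLE.mul {f g : MvPowerSeries ℕ ℂ} {M N : ℕ} (hf : ExpLE f M) (hg : ExpLE g N) :
    ExpLE (f * g) (M + N) := fun a ha i => by
  rw [coeff_mul] at ha
  obtain ⟨p, hp, hne⟩ := Finset.exists_ne_zero_of_sum_ne_zero ha
  rw [← HasAntidiagonal.mem_antidiagonal.1 hp]
  exact add_le_add (hf _ (left_ne_zero_of_mul hne) i) (hg _ (right_ne_zero_of_mul hne) i)

lemma ExpLE.prod {ι : Type*} {s : Finset ι} {f : ι → MvPowerSeries ℕ ℂ} {N : ι → ℕ}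
    (h : ∀ i ∈ s, ExpLE (f i) (N i)) : ExpLE (∏ i ∈ s, f i) (∑ i ∈ s, N i) := by
  classical
  induction s using Finset.induction_on with
  | empty => simpa using ExpLE.one 0
  | insert a s ha ih =>
    rw [prod_insert ha, sum_insert ha]
    exact (h a (mem_insert_self a s)).mul (ih fun i hi => h i (mem_insert_of_mem hi))

lemma exists_eq_smul_of_forall_dvd {a : ℕ →₀ ℕ} {k : ℕ} (h : ∀ i, k ∣ a i) :
    ∃ b : ℕ →₀ ℕ, a = k • b := by
  refine ⟨a.mapRange (· / k) (Nat.zero_div k), ?_⟩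
  ext j
  simp [Nat.mul_div_cancel' (h j)]

lemma ExpLE.expand {f : MvPowerSeries ℕ ℂ} {N : ℕ} (hf : ExpLE f N) {k : ℕ} (hk : k ≠ 0) :
    ExpLE (expand k hk f) (k * N) := fun a ha i => by
  by_cases h : ∀ i, k ∣ a i
  · obtain ⟨b, rfl⟩ := exists_eq_smul_of_forall_dvd h
    rw [coeff_expand_smul] at ha
    simpa using Nat.mul_le_mul_left k (hf b ha i)
  · push Not at h
    obtain ⟨j, hj⟩ := h
    exact absurd (coeff_expand_of_not_dvd k hk f hj) ha

/-! ### Coefficients of the classical symmetric functions -/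

open Classical in
lemma coeff_psum (k : ℕ) (a : ℕ →₀ ℕ) :
    coeff a (psum k) = if ∃ i, a = Finsupp.single i k then 1 else 0 := by
  rfl

lemma coeff_hsymm (d : ℕ) (a : ℕ →₀ ℕ) : coeff a (hsymm d) = if a.degree = d then 1 else 0 := rfl

open Classical in
lemma coeff_esymm (d : ℕ) (a : ℕ →₀ ℕ) :
    coeff a (esymm d) = if a.degree = d ∧ ∀ i, a i ≤ 1 then 1 else 0 := by
  rfl

lemma coeff_single_psum (k i : ℕ) : coeff (Finsupp.single i k) (psum k) = 1 := by
  rw [coeff_psum, if_pos ⟨i, rfl⟩]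

lemma expLE_esymm (d : ℕ) : ExpLE (esymm d) 1 := fun a ha i => by
  classical
  rw [coeff_esymm] at ha
  by_contra h
  exact ha (if_neg fun h' => h (h'.2 i))

lemma coeff_psum_mul {k : ℕ} (hk : k ≠ 0) (f : MvPowerSeries ℕ ℂ) (a : ℕ →₀ ℕ) :
    coeff a (psum k * f) =
      ∑ i ∈ a.support with k ≤ a i, coeff (a - Finsupp.single i k) f := by
  rw [coeff_mul]
  symm
  refine sum_of_injOn (fun i => (Finsupp.single i k, a - Finsupp.single i k)) ?_ ?_ ?_ ?_
  · intro i _ j _ hij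
    exact (Finsupp.single_left_inj hk).1 (congrArg Prod.fst hij)
  · intro i hi
    simp only [coe_filter, Set.mem_ofPred_eq] at hi
    simp only [mem_coe, HasAntidiagonal.mem_antidiagonal]
    refine add_tsub_cancel_of_le ?_
    rw [Finsupp.single_le_iff]
    exact hi.2
  · rintro ⟨b, c⟩ hbc hni
    rw [coeff_psum]
    split_ifs with h
    · obtain ⟨i, rfl⟩ := h
      refine absurd ?_ hni
      rw [HasAntidiagonal.mem_antidiagonal] at hbc
      dsimp only at hbc
      subst hbc
      refine ⟨i, ?_, ?_⟩
      · rw [mem_coe, mem_filter, Finsupp.mem_support_iff, Finsupp.add_apply,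
          Finsupp.single_eq_same]
        omega
      · simp
    · simp
  · intro i _
    rw [coeff_single_psum, one_mul]

lemma hsymm_zero : hsymm 0 = 1 := by
  ext a
  rw [coeff_hsymm, coeff_one]
  simp only [Finsupp.degree_eq_zero_iff]

lemma esymm_zero : esymm 0 = 1 := by
  classical
  ext a
  rw [coeff_esymm, coeff_one]
  by_cases h : a = 0 <;> simp [h, Finsupp.degree_eq_zero_iff]

lemma degree_sub_single {a : ℕ →₀ ℕ} {i k : ℕ} (h : k ≤ a i) :
    (a - Finsupp.single i k).degree + k = a.degree := by
  have : a - Finsupp.single i k + Finsupp.single i k = a :=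
    tsub_add_cancel_of_le (Finsupp.single_le_iff.2 h)
  conv_rhs => rw [← this, map_add, Finsupp.degree_single]

/-- At a monomial of degree `m + 1` the right side counts the pairs `(i, k)` with `k < a i`, whose
number is the degree. -/
lemma newton_hsymm (m : ℕ) :
    ((m + 1 : ℕ) : ℂ) • hsymm (m + 1) = ∑ k ∈ range (m + 1), psum (k + 1) * hsymm (m - k) := by
  ext a
  rw [map_sum, coeff_smul, coeff_hsymm]
  simp only [coeff_psum_mul (Nat.succ_ne_zero _), coeff_hsymm]
  have key : ∀ k ∈ range (m + 1), (∑ i ∈ a.support with k + 1 ≤ a i,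
      if (a - Finsupp.single i (k + 1)).degree = m - k then (1 : ℂ) else 0) =
      if a.degree = m + 1 then ((#{i ∈ a.support | k + 1 ≤ a i} : ℕ) : ℂ) else 0 := by
    intro k hk
    rw [mem_range] at hk
    have : ∀ i ∈ a.support.filter (k + 1 ≤ a ·), (if (a - Finsupp.single i (k + 1)).degree = m - k
        then (1 : ℂ) else 0) = if a.degree = m + 1 then 1 else 0 := by
      intro i hi
      have := degree_sub_single (mem_filter.1 hi).2
      refine if_congr ?_ rfl rfl
      omega
    rw [sum_congr rfl this]
    simp
  rw [sum_congr rfl key]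
  split_ifs with h
  · rw [mul_one, ← Nat.cast_sum]
    congr 1
    simp only [card_filter]
    rw [sum_comm]
    conv_lhs => rw [← h, Finsupp.degree_apply]
    refine sum_congr rfl fun i hi => ?_
    rw [← card_filter]
    have : {k ∈ range (m + 1) | k + 1 ≤ a i} = range (a i) := by
      ext k
      have := Finsupp.le_degree i a
      simp only [mem_filter, mem_range]
      omega
    rw [this, card_range]
  · simp

/-- A squarefree monomial arises only from `k = 0`, once for each of its variables. If exactly one
exponent is `r + 2 ≥ 2`, only `k = r` and `k = r + 1` contribute, with opposite signs. With two such
exponents nothing contributes. -/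
lemma newton_esymm (m : ℕ) :
    ((m + 1 : ℕ) : ℂ) • esymm (m + 1) =
      ∑ k ∈ range (m + 1), (-1 : ℂ) ^ k • (psum (k + 1) * esymm (m - k)) := by
  classical
  ext a
  rw [map_sum, coeff_smul, coeff_esymm]
  simp only [coeff_smul, coeff_psum_mul (Nat.succ_ne_zero _), coeff_esymm]
  have key : ∀ k ∈ range (m + 1), ((-1 : ℂ) ^ k * ∑ i ∈ a.support with k + 1 ≤ a i,
      if (a - Finsupp.single i (k + 1)).degree = m - k ∧
        ∀ j, (a - Finsupp.single i (k + 1)) j ≤ 1 then (1 : ℂ) else 0) =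
      if a.degree = m + 1 then ∑ i ∈ a.support,
        if (∀ j ≠ i, a j ≤ 1) ∧ k + 1 ≤ a i ∧ a i ≤ k + 2 then (-1 : ℂ) ^ k else 0 else 0 := by
    intro k hk
    rw [mem_range] at hk
    have : ∀ i ∈ a.support, (if k + 1 ≤ a i then (if (a - Finsupp.single i (k + 1)).degree = m - k ∧
        ∀ j, (a - Finsupp.single i (k + 1)) j ≤ 1 then (1 : ℂ) else 0) else 0) =
        if a.degree = m + 1 then (if (∀ j ≠ i, a j ≤ 1) ∧ k + 1 ≤ a i ∧ a i ≤ k + 2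
          then 1 else 0) else 0 := by
      intro i _
      by_cases h : k + 1 ≤ a i
      · have h1 := degree_sub_single h
        have h2 : (a - Finsupp.single i (k + 1)).degree = m - k ↔ a.degree = m + 1 := by omega
        have h3 : (∀ j, (a - Finsupp.single i (k + 1)) j ≤ 1) ↔
            (∀ j ≠ i, a j ≤ 1) ∧ k + 1 ≤ a i ∧ a i ≤ k + 2 := by
          constructor
          · intro H
            refine ⟨fun j hj => ?_, h, ?_⟩
            · simpa [Finsupp.single_apply, hj.symm] using H j
            · have := H i
              simp at this
              omega
          · rintro ⟨H, -, H'⟩ j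
            by_cases hj : j = i
            · subst hj
              simp
              omega
            · simpa [Finsupp.single_apply, Ne.symm hj] using H j hj
        rw [if_pos h, ← ite_and]
        exact if_congr (and_congr h2 h3) rfl rfl
      · simp [h]
    rw [sum_filter, sum_congr rfl this]
    split_ifs
    · rw [mul_sum]
      simp
    · simp
  rw [sum_congr rfl key]
  by_cases h : a.degree = m + 1
  · simp only [h, if_true, true_and]
    rw [sum_comm]
    by_cases hs : ∀ i, a i ≤ 1
    · rw [if_pos hs, mul_one]
      have : ∀ i ∈ a.support, (∑ k ∈ range (m + 1), if (∀ j ≠ i, a j ≤ 1) ∧ k + 1 ≤ a i ∧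
          a i ≤ k + 2 then (-1 : ℂ) ^ k else 0) = 1 := by
        intro i hi
        rw [sum_eq_single 0]
        · have := hs i
          rw [Finsupp.mem_support_iff] at hi
          rw [if_pos ⟨fun j _ => hs j, by omega, by omega⟩, pow_zero]
        · intro k _ hk
          have := hs i
          exact if_neg fun H => by omega
        · simp
      rw [sum_congr rfl this, ← h, Finsupp.degree_apply, Nat.cast_sum]
      refine sum_congr rfl fun i hi => ?_
      have := hs i
      rw [Finsupp.mem_support_iff] at hi
      rw [show a i = 1 by omega, Nat.cast_one]
    · rw [if_neg hs, mul_zero]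
      push Not at hs
      obtain ⟨i₀, hi₀⟩ := hs
      symm
      refine sum_eq_zero fun i _ => ?_
      by_cases hi : ∀ j ≠ i, a j ≤ 1
      · have hii : i₀ = i := by
          by_contra hne
          have := hi i₀ hne
          omega
        subst hii
        have hle := Finsupp.le_degree i₀ a
        obtain ⟨r, hr⟩ : ∃ r, a i₀ = r + 2 := ⟨a i₀ - 2, by omega⟩
        have : ∀ k ∈ range (m + 1), (if (∀ j ≠ i₀, a j ≤ 1) ∧ k + 1 ≤ a i₀ ∧
            a i₀ ≤ k + 2 then (-1 : ℂ) ^ k else 0) =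
            (if k = r then (-1 : ℂ) ^ k else 0) + if k = r + 1 then (-1 : ℂ) ^ k else 0 := by
          intro k _
          by_cases h1 : k = r
          · subst h1
            rw [if_pos ⟨hi, by omega, by omega⟩]
            simp
          · by_cases h2 : k = r + 1
            · subst h2
              rw [if_pos ⟨hi, by omega, by omega⟩]
              simp
            · rw [if_neg (by omega), if_neg h1, if_neg h2, add_zero]
        rw [sum_congr rfl this, sum_add_distrib, sum_ite_eq', sum_ite_eq', if_pos, if_pos]
        · ring
        · rw [mem_range]; omega
        · rw [mem_range]; omega
      · exact sum_eq_zero fun k _ => if_neg fun H => hi H.1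
  · simp [h]

/-! ### The leading monomial of a Schur function -/

/-- The weight `∑ k * a_k` of an exponent vector. -/
def wt : (ℕ →₀ ℕ) →+ ℕ := Finsupp.weight id

lemma wt_single (k c : ℕ) : wt (Finsupp.single k c) = c * k := by
  simp [wt, Finsupp.weight_single]

/-- The monomial `x^a₀` has coefficient `c` in `f`, and all other monomials of `f` have a larger
weight. -/
def HasLead (f : MvPowerSeries ℕ ℂ) (a₀ : ℕ →₀ ℕ) (c : ℂ) : Prop :=
  coeff a₀ f = c ∧ ∀ a, coeff a f ≠ 0 → a ≠ a₀ → wt a₀ < wt a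

lemma HasLead.wt_le {f : MvPowerSeries ℕ ℂ} {a₀ a : ℕ →₀ ℕ} {c : ℂ} (h : HasLead f a₀ c)
    (ha : coeff a f ≠ 0) : wt a₀ ≤ wt a := by
  by_cases h' : a = a₀
  · rw [h']
  · exact (h.2 a ha h').le

lemma HasLead.one : HasLead 1 0 1 := by
  refine ⟨coeff_zero_one, fun a ha hne => absurd ?_ ha⟩
  rw [coeff_one, if_neg hne]

lemma HasLead.mul {f g : MvPowerSeries ℕ ℂ} {a b : ℕ →₀ ℕ} {c d : ℂ} (hf : HasLead f a c)
    (hg : HasLead g b d) : HasLead (f * g) (a + b) (c * d) := by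
  have key : ∀ p : (ℕ →₀ ℕ) × (ℕ →₀ ℕ), coeff p.1 f * coeff p.2 g ≠ 0 →
      p ≠ (a, b) → wt (a + b) < wt (p.1 + p.2) := by
    intro p hp hne
    have h1 := hf.wt_le (left_ne_zero_of_mul hp)
    have h2 := hg.wt_le (right_ne_zero_of_mul hp)
    rw [map_add, map_add]
    by_cases h3 : p.1 = a
    · have h4 : p.2 ≠ b := fun h4 => hne (Prod.ext h3 h4)
      have := hg.2 _ (right_ne_zero_of_mul hp) h4
      omega
    · have := hf.2 _ (left_ne_zero_of_mul hp) h3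
      omega
  constructor
  · rw [coeff_mul, sum_eq_single (a, b)]
    · rw [hf.1, hg.1]
    · intro p hp hne
      by_contra h
      have := key p h hne
      rw [HasAntidiagonal.mem_antidiagonal] at hp
      rw [hp] at this
      exact lt_irrefl _ this
    · intro h
      simp at h
  · intro e he hne
    rw [coeff_mul] at he
    obtain ⟨p, hp, hpne⟩ := exists_ne_zero_of_sum_ne_zero he
    rw [HasAntidiagonal.mem_antidiagonal] at hp
    rw [← hp]
    refine key p hpne ?_
    rintro rfl
    exact hne hp.symm

lemma HasLead.prod {ι : Type*} (s : Finset ι) {f : ι → MvPowerSeries ℕ ℂ} {a : ι → ℕ →₀ ℕ}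
    (h : ∀ i ∈ s, HasLead (f i) (a i) 1) : HasLead (∏ i ∈ s, f i) (∑ i ∈ s, a i) 1 := by
  classical
  induction s using Finset.induction_on with
  | empty => simpa using HasLead.one
  | insert i s hi ih =>
    rw [prod_insert hi, sum_insert hi]
    simpa using (h i (mem_insert_self i s)).mul (ih fun j hj => h j (mem_insert_of_mem hj))

/-- The exponent vector of `x_0 x_1 ⋯ x_{d-1}`. -/
def stair (d : ℕ) : ℕ →₀ ℕ := ∑ k ∈ range d, Finsupp.single k 1

lemma stair_apply (d k : ℕ) : stair d k = if k < d then 1 else 0 := by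
  simp [stair, Finsupp.finsetSum_apply, Finsupp.single_apply]

lemma degree_stair (d : ℕ) : (stair d).degree = d := by
  simp [stair]

lemma wt_stair (d : ℕ) : wt (stair d) = ∑ k ∈ range d, k := by
  simp [stair, wt_single]

/-- The two set differences have the same size; one lies below `#s`, the other at or above it. -/
lemma sum_range_lt_sum {s : Finset ℕ} (hs : s ≠ range #s) : ∑ k ∈ range #s, k < ∑ k ∈ s, k := by
  rw [← sum_inter_add_sum_sdiff s (range #s), ← sum_inter_add_sum_sdiff (range #s) s, inter_comm]
  refine Nat.add_lt_add_left ?_ _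
  have hc : #(range #s \ s) = #(s \ range #s) := by
    have h1 := card_sdiff_add_card_inter s (range #s)
    have h2 := card_sdiff_add_card_inter (range #s) s
    rw [inter_comm, card_range] at h2
    omega
  have hpos : (range #s \ s).Nonempty := by
    rw [nonempty_iff_ne_empty, Ne, sdiff_eq_empty_iff_subset]
    intro hsub
    exact hs (eq_of_subset_of_card_le hsub (by simp)).symm
  calc ∑ k ∈ range #s \ s, k < ∑ k ∈ range #s \ s, #s :=
        sum_lt_sum_of_nonempty hpos fun i hi => mem_range.1 (mem_sdiff.1 hi).1
    _ = ∑ k ∈ s \ range #s, #s := by rw [sum_const, sum_const, hc]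
    _ ≤ ∑ k ∈ s \ range #s, k := sum_le_sum fun i hi => by
        have := (mem_sdiff.1 hi).2
        rw [mem_range] at this
        omega

/-- The weight of a squarefree monomial is the sum of its indices, least for the first `d` indices.
-/
lemma hasLead_esymm (d : ℕ) : HasLead (esymm d) (stair d) 1 := by
  classical
  constructor
  · rw [coeff_esymm, if_pos]
    refine ⟨degree_stair d, fun i => ?_⟩
    rw [stair_apply]
    split_ifs <;> simp
  · intro a ha hne
    rw [coeff_esymm] at ha
    obtain ⟨hd, hsq⟩ : a.degree = d ∧ ∀ i, a i ≤ 1 := by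
      by_contra h
      exact ha (if_neg h)
    have hval : ∀ i ∈ a.support, a i = 1 := fun i hi => by
      have := hsq i
      rw [Finsupp.mem_support_iff] at hi
      omega
    have hcard : #a.support = d := by
      rw [← hd, Finsupp.degree_apply, sum_congr rfl hval]
      simp
    have hw : wt a = ∑ k ∈ a.support, k := by
      rw [wt, Finsupp.weight_apply, Finsupp.sum]
      refine sum_congr rfl fun i hi => ?_
      simp [hval i hi]
    rw [wt_stair, hw, ← hcard]
    refine sum_range_lt_sum fun h => hne ?_
    rw [hcard] at h
    ext k
    rw [stair_apply]
    split_ifs with hk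
    · exact hval k (by rw [h]; exact mem_range.2 hk)
    · rw [← Finsupp.notMem_support_iff, h, mem_range]
      exact hk

/-! ### Column lengths and the determinant defining a Schur function. -/

lemma expLE_esymmInt (k : ℤ) : ExpLE (esymmInt k) 1 := by
  rw [esymmInt]
  split_ifs
  · exact ExpLE.zero 1
  · exact expLE_esymm _

lemma conjPart_antitone {n : ℕ} (lam : n.Partition) : Antitone (conjPart lam) := fun _ _ hij =>
  Multiset.card_le_card (Multiset.monotone_filter_right _ fun _ hp => hij.trans_lt hp)

lemma conjPart_pos {n : ℕ} (lam : n.Partition) {i : ℕ} (hi : i < firstPart lam) :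
    0 < conjPart lam i := by
  rw [conjPart, Multiset.card_pos_iff_exists_mem]
  by_contra! h
  refine hi.not_ge (Multiset.sup_le.2 fun p hp => ?_)
  by_contra! hlt
  exact h p (Multiset.mem_filter.2 ⟨hp, hlt⟩)

lemma conjPart_eq_zero {n : ℕ} (lam : n.Partition) {i : ℕ} (hi : firstPart lam ≤ i) :
    conjPart lam i = 0 := by
  rw [conjPart, Multiset.card_eq_zero, Multiset.filter_eq_nil]
  intro p hp
  have : p ≤ firstPart lam := Multiset.le_sup hp
  omega

lemma sum_card_filter_lt (F : ℕ) (s : Multiset ℕ) (h : ∀ p ∈ s, p ≤ F) :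
    ∑ i ∈ range F, (s.filter fun p => i < p).card = s.sum := by
  induction s using Multiset.induction_on with
  | empty => simp
  | cons p s ih =>
    have hp : p ≤ F := h p (Multiset.mem_cons_self p s)
    have : ∀ i ∈ range F, ((p ::ₘ s).filter fun q => i < q).card =
        (if i < p then 1 else 0) + (s.filter fun q => i < q).card := by
      intro i _
      rw [Multiset.filter_cons]
      split_ifs <;> simp [add_comm]
    rw [sum_congr rfl this, sum_add_distrib, ih fun q hq => h q (Multiset.mem_cons_of_mem hq),
      Multiset.sum_cons, ← card_filter]
    congr 1
    have : {i ∈ range F | i < p} = range p := by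
      ext i
      simp only [mem_filter, mem_range]
      omega
    rw [this, card_range]

lemma sum_conjPart {n : ℕ} (lam : n.Partition) :
    ∑ i : Fin (firstPart lam), conjPart lam i = n := by
  rw [Fin.sum_univ_eq_sum_range]
  exact (sum_card_filter_lt _ _ fun p hp => Multiset.le_sup hp).trans lam.parts_sum

/-- The exponent vector of the leading monomial `x^λ` of `s_λ`. -/
def lead {n : ℕ} (lam : n.Partition) : ℕ →₀ ℕ :=
  ∑ i : Fin (firstPart lam), stair (conjPart lam i)

lemma lead_apply {n : ℕ} (lam : n.Partition) (k : ℕ) :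
    lead lam k = #{i ∈ range (firstPart lam) | k < conjPart lam i} := by
  rw [lead, Finsupp.finsetSum_apply, card_filter, ← Fin.sum_univ_eq_sum_range
    (fun i => if k < conjPart lam i then 1 else 0)]
  simp only [stair_apply]

lemma lead_zero {n : ℕ} (lam : n.Partition) : lead lam 0 = firstPart lam := by
  rw [lead_apply, filter_true_of_mem fun i hi => conjPart_pos lam (mem_range.1 hi), card_range]

/-- Both sides say that the cell in row `k`, column `i` belongs to the diagram, since the column
lengths decrease. -/
lemma lt_lead_iff {n : ℕ} (lam : n.Partition) (i k : ℕ) :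
    i < lead lam k ↔ k < conjPart lam i := by
  rw [lead_apply]
  constructor
  · intro h
    by_contra! hk
    refine h.not_ge ((card_le_card fun j hj => ?_).trans_eq (card_range i))
    rw [mem_filter] at hj
    rw [mem_range]
    by_contra! hij
    have := conjPart_antitone lam hij
    omega
  · intro h
    have hi : i < firstPart lam := by
      by_contra! hF
      rw [conjPart_eq_zero lam hF] at h
      omega
    rw [← Nat.succ_le_iff, ← card_range i.succ]
    refine card_le_card fun j hj => ?_
    rw [mem_range] at hj
    have := conjPart_antitone lam (Nat.lt_succ_iff.1 hj)
    rw [mem_filter, mem_range]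
    omega

/-- The row lengths determine the columns, and the multiplicity of a part is the difference of two
consecutive column lengths. -/
lemma parts_eq_of_lead_eq {n m : ℕ} {lam : n.Partition} {mu : m.Partition}
    (h : lead lam = lead mu) : lam.parts = mu.parts := by
  have hc : ∀ i, conjPart lam i = conjPart mu i := fun i =>
    eq_of_forall_lt_iff fun k => by rw [← lt_lead_iff, ← lt_lead_iff, h]
  have hcount : ∀ (s : Multiset ℕ) (p : ℕ), s.count (p + 1) + (s.filter fun q => p + 1 < q).card =
      (s.filter fun q => p < q).card := by
    intro s p
    induction s using Multiset.induction_on with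
    | empty => simp
    | cons q s ih =>
      rw [Multiset.count_cons, Multiset.filter_cons, Multiset.filter_cons, Multiset.card_add,
        Multiset.card_add]
      split_ifs <;> simp <;> omega
  ext p
  rcases p with _ | p
  · rw [Multiset.count_eq_zero_of_notMem fun h0 => absurd (lam.parts_pos h0) (lt_irrefl 0),
      Multiset.count_eq_zero_of_notMem fun h0 => absurd (mu.parts_pos h0) (lt_irrefl 0)]
  · have h1 := hcount lam.parts p
    have h2 := hcount mu.parts p
    have h3 := hc p
    have h4 := hc (p + 1)
    simp only [conjPart] at h3 h4
    omega

lemma sigma_eq_of_lead_eq {lam mu : Σ n : ℕ, n.Partition} (h : lead lam.2 = lead mu.2) :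
    lam = mu := by
  obtain ⟨n, lam⟩ := lam
  obtain ⟨m, mu⟩ := mu
  have hp : lam.parts = mu.parts := parts_eq_of_lead_eq h
  obtain rfl : n = m := by rw [← lam.parts_sum, ← mu.parts_sum, hp]
  rw [Nat.Partition.ext hp]

lemma eq_one_of_forall_lt {n : ℕ} {σ : Equiv.Perm (Fin n)} (h : ∀ i j, i < j → σ i < σ j) :
    σ = 1 := by
  have hm : StrictMono σ := fun i j => h i j
  have := Subsingleton.elim (hm.orderIsoOfSurjective σ σ.surjective) (OrderIso.refl (Fin n))
  ext i
  have := DFunLike.congr_fun this i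
  simpa using congrArg Fin.val this

lemma two_mul_sum_range_id (d : ℕ) : 2 * ((∑ k ∈ range d, k : ℕ) : ℤ) = (d : ℤ) ^ 2 - d := by
  induction d with
  | zero => simp
  | succ d ih =>
    rw [sum_range_succ]
    push_cast at ih ⊢
    linarith

/-- Rearrangement inequality: `c i - i` is strictly decreasing and `i` strictly increasing. After
expanding the squares only the cross term depends on `σ`, and it is strictly smallest at the
identity. -/
lemma sum_sq_lt {F : ℕ} {c : ℕ → ℕ} (hc : Antitone c) {σ : Equiv.Perm (Fin F)} (hσ : σ ≠ 1) :
    ∑ i : Fin F, (c i : ℤ) ^ 2 < ∑ i : Fin F, ((c (σ i) : ℤ) - (σ i : ℕ) + (i : ℕ)) ^ 2 := by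
  let f : Fin F → ℤ := fun i => (c i : ℤ) - (i : ℕ)
  let g : Fin F → ℤ := fun i => (i : ℕ)
  have hf : StrictAnti f := fun i j hij => by
    have h1 : c j ≤ c i := hc (Fin.lt_def.1 hij).le
    have h2 : (i : ℕ) < j := hij
    simp only [f]
    omega
  have hg : StrictMono g := fun i j hij => by
    have h2 : (i : ℕ) < j := hij
    simp only [g]
    omega
  have hfg : Antivary f g := fun i j hij => (hf (hg.lt_iff_lt.1 hij)).le
  have hlt : ∑ i, f i * g i < ∑ i, f (σ i) * g i := by
    have := hfg.sum_smul_lt_sum_comp_perm_smul_iff (σ := σ)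
    simp only [smul_eq_mul] at this
    rw [this]
    intro hanti
    refine hσ (eq_one_of_forall_lt fun i j hij => ?_)
    have := hanti (hg hij)
    have hle : σ i ≤ σ j := hf.le_iff_ge.1 this
    exact lt_of_le_of_ne hle fun h => hij.ne (σ.injective h)
  have h1 : ∀ i : Fin F, (c i : ℤ) ^ 2 = f i ^ 2 + g i ^ 2 + 2 * (f i * g i) := fun i => by
    simp only [f, g]
    ring
  have h2 : ∀ i : Fin F, ((c (σ i) : ℤ) - (σ i : ℕ) + (i : ℕ)) ^ 2 =
      f (σ i) ^ 2 + g i ^ 2 + 2 * (f (σ i) * g i) := fun i => by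
    simp only [f, g]
    ring
  simp only [h1, h2, sum_add_distrib, ← mul_sum]
  rw [Equiv.sum_comp σ fun i => f i ^ 2]
  linarith

lemma schur_eq_sum {n : ℕ} (lam : n.Partition) :
    schur lam = ∑ σ : Equiv.Perm (Fin (firstPart lam)), ((Equiv.Perm.sign σ : ℤ) : ℂ) •
      ∏ i : Fin (firstPart lam),
        esymmInt ((conjPart lam (σ i) : ℤ) - ((σ i : ℕ) : ℤ) + ((i : ℕ) : ℤ)) := by
  rw [schur, Matrix.det_apply]
  refine sum_congr rfl fun σ _ => ?_
  rw [Units.smul_def, Int.cast_smul_eq_zsmul]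
  rfl

lemma expLE_schur {n : ℕ} (lam : n.Partition) : ExpLE (schur lam) (firstPart lam) := by
  rw [schur_eq_sum]
  refine ExpLE.sum fun σ _ => ExpLE.smul ?_ _
  have := ExpLE.prod (s := univ) (N := fun _ => 1) fun i _ => expLE_esymmInt
    ((conjPart lam (σ i) : ℤ) - ((σ i : ℕ) : ℤ) + ((i : ℕ) : ℤ))
  simpa using this

/-- The terms of the determinant other than the diagonal one have only monomials of weight larger
than that of `x^λ`. -/
lemma wt_lead_lt {n : ℕ} (lam : n.Partition) {σ : Equiv.Perm (Fin (firstPart lam))} (hσ : σ ≠ 1)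
    {a : ℕ →₀ ℕ} (ha : coeff a (∏ i : Fin (firstPart lam),
      esymmInt ((conjPart lam (σ i) : ℤ) - ((σ i : ℕ) : ℤ) + ((i : ℕ) : ℤ))) ≠ 0) :
    wt (lead lam) < wt a := by
  set ν : Fin (firstPart lam) → ℤ := fun i =>
    (conjPart lam (σ i) : ℤ) - ((σ i : ℕ) : ℤ) + ((i : ℕ) : ℤ) with hν
  have hpos : ∀ i, 0 ≤ ν i := by
    by_contra! h
    obtain ⟨i, hi⟩ := h
    refine ha ?_
    rw [prod_eq_zero (mem_univ i) (by rw [esymmInt, if_pos hi]), map_zero]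
  have hl : HasLead (∏ i, esymmInt (ν i)) (∑ i, stair (ν i).toNat) 1 :=
    HasLead.prod univ fun i _ => by
      rw [esymmInt, if_neg (hpos i).not_gt]
      exact hasLead_esymm _
  refine lt_of_lt_of_le ?_ (hl.wt_le ha)
  rw [lead, map_sum, map_sum]
  simp only [wt_stair]
  -- The least weight in the term of `σ` is `∑ ν i (ν i - 1) / 2`. As `∑ ν i` does not depend on
  -- `σ`, comparing weights amounts to comparing sums of squares.
  have h1 := sum_sq_lt (conjPart_antitone lam) hσ
  have h2 : ∑ i, ν i = ∑ i : Fin (firstPart lam), (conjPart lam i : ℤ) := by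
    simp only [hν, sum_add_distrib, sum_sub_distrib]
    rw [Equiv.sum_comp σ fun i => (conjPart lam i : ℤ),
      Equiv.sum_comp σ fun i : Fin (firstPart lam) => ((i : ℕ) : ℤ)]
    ring
  have h3 : 2 * ((∑ i : Fin (firstPart lam), ∑ k ∈ range (conjPart lam i), k : ℕ) : ℤ) =
      ∑ i : Fin (firstPart lam), (conjPart lam i : ℤ) ^ 2 -
        ∑ i : Fin (firstPart lam), (conjPart lam i : ℤ) := by
    rw [← sum_sub_distrib, Nat.cast_sum, mul_sum]
    exact sum_congr rfl fun i _ => two_mul_sum_range_id _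
  have h4 : 2 * ((∑ i, ∑ k ∈ range (ν i).toNat, k : ℕ) : ℤ) = ∑ i, ν i ^ 2 - ∑ i, ν i := by
    rw [← sum_sub_distrib, Nat.cast_sum, mul_sum]
    refine sum_congr rfl fun i _ => ?_
    rw [two_mul_sum_range_id, Int.toNat_of_nonneg (hpos i)]
  have : ∑ i : Fin (firstPart lam), (conjPart lam i : ℤ) ^ 2 < ∑ i, ν i ^ 2 := h1
  zify
  push_cast at h3 h4
  linarith

lemma hasLead_schur {n : ℕ} (lam : n.Partition) : HasLead (schur lam) (lead lam) 1 := by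
  classical
  have hdiag : HasLead (∏ i : Fin (firstPart lam), esymmInt ((conjPart lam i : ℤ) -
      ((i : ℕ) : ℤ) + ((i : ℕ) : ℤ))) (lead lam) 1 :=
    HasLead.prod univ fun i _ => by
      rw [sub_add_cancel, esymmInt, if_neg (by omega), Int.toNat_natCast]
      exact hasLead_esymm _
  have hone := fun σ : Equiv.Perm (Fin (firstPart lam)) => fun hσ : σ ≠ 1 =>
    fun a => wt_lead_lt lam hσ (a := a)
  rw [schur_eq_sum, ← add_sum_erase _ _ (mem_univ 1)]
  simp only [Equiv.Perm.sign_one, Units.val_one, Int.cast_one, one_smul, Equiv.Perm.one_apply]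
  constructor
  · rw [map_add, hdiag.1, map_sum, sum_eq_zero, add_zero]
    intro σ hσ
    rw [coeff_smul]
    by_contra h
    exact lt_irrefl _ (wt_lead_lt lam (mem_erase.1 hσ).1 (right_ne_zero_of_mul h))
  · intro a ha hne
    by_cases h : coeff a (∏ i : Fin (firstPart lam), esymmInt ((conjPart lam i : ℤ) -
      ((i : ℕ) : ℤ) + ((i : ℕ) : ℤ))) = 0
    · rw [map_add, h, zero_add, map_sum] at ha
      obtain ⟨σ, hσ, hσne⟩ := exists_ne_zero_of_sum_ne_zero ha
      rw [coeff_smul] at hσne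
      exact wt_lead_lt lam (mem_erase.1 hσ).1 (right_ne_zero_of_mul hσne)
    · exact hdiag.2 a h hne

/-- Some monomial `x^μ` with `μ₁` maximal survives in a nonzero combination of Schur functions. -/
lemma exists_coeff_lead {c : (Σ n : ℕ, n.Partition) →₀ ℂ} (hc : c ≠ 0) :
    ∃ μ, c μ ≠ 0 ∧ (∀ lam, c lam ≠ 0 → firstPart lam.2 ≤ firstPart μ.2) ∧
      coeff (lead μ.2) (schurSum c) = c μ := by
  classical
  -- First maximize `λ₁`, then minimize the weight. If `s_ν` contains `x^μ`, its exponent bound at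
  -- `x_0` forces `ν₁ = μ₁`, and minimality of the weight then forces `ν = μ`.
  obtain ⟨κ, hκ, hmax⟩ := exists_max_image c.support (fun κ => firstPart κ.2)
    (Finsupp.support_nonempty_iff.2 hc)
  obtain ⟨μ, hμ, hmin⟩ := exists_min_image {μ ∈ c.support | firstPart μ.2 = firstPart κ.2}
    (fun μ => wt (lead μ.2)) ⟨κ, mem_filter.2 ⟨hκ, rfl⟩⟩
  rw [mem_filter] at hμ
  refine ⟨μ, Finsupp.mem_support_iff.1 hμ.1, fun lam hlam => ?_, ?_⟩
  · rw [hμ.2]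
    exact hmax lam (Finsupp.mem_support_iff.2 hlam)
  rw [schurSum, Finsupp.sum, map_sum, sum_eq_single μ]
  · rw [coeff_smul, (hasLead_schur μ.2).1, mul_one]
  · intro ν hν hne
    rw [coeff_smul]
    by_contra h0
    have h1 := right_ne_zero_of_mul h0
    have h2 := expLE_schur ν.2 _ h1 0
    rw [lead_zero, hμ.2] at h2
    have h3 := hmin ν (mem_filter.2 ⟨hν, le_antisymm (hmax ν hν) h2⟩)
    by_cases h4 : lead μ.2 = lead ν.2
    · exact hne (sigma_eq_of_lead_eq h4).symm
    · exact absurd ((hasLead_schur ν.2).2 _ h1 h4) h3.not_gt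
  · intro hn
    exact absurd hμ.1 hn

/-- In a combination of Schur functions all of whose monomials have exponents at most `N`, only
the `s_λ` with `λ₁ ≤ N` occur. -/
lemma firstPart_le_of_expLE {c : (Σ n : ℕ, n.Partition) →₀ ℂ} {N : ℕ}
    (h : ExpLE (schurSum c) N) {lam : Σ n : ℕ, n.Partition} (hlam : c lam ≠ 0) :
    firstPart lam.2 ≤ N := by
  obtain ⟨μ, hμ, hmax, hcoeff⟩ := exists_coeff_lead (c := c) fun h0 => hlam (by simp [h0])
  refine (hmax lam hlam).trans ?_
  rw [← lead_zero]
  exact h _ (by rwa [hcoeff]) 0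

/-! ### Linear independence of the Schur functions. -/

lemma schurSum_eq_linearCombination (c : (Σ n : ℕ, n.Partition) →₀ ℂ) :
    schurSum c = Finsupp.linearCombination ℂ (fun lam => schur lam.2) c := rfl

lemma linearIndependent_schur :
    LinearIndependent ℂ fun lam : Σ n : ℕ, n.Partition => schur lam.2 := by
  rw [linearIndependent_iff]
  intro c hc
  by_contra hne
  obtain ⟨μ, hμ, -, hcoeff⟩ := exists_coeff_lead hne
  rw [schurSum_eq_linearCombination, hc, map_zero] at hcoeff
  exact hμ hcoeff.symm

lemma schurSum_injective : Function.Injective schurSum :=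
  linearIndependent_schur

lemma isSchurExpansion (c : (Σ n : ℕ, n.Partition) →₀ ℂ) : IsSchurExpansion (schurSum c) c :=
  fun _ => schurSum_injective.eq_iff

/-! ### The graded pieces of the ring of symmetric functions -/

/-- The product of power sums `p_λ`. -/
def psumProd (s : Multiset ℕ) : MvPowerSeries ℕ ℂ := (s.map psum).prod

lemma psumProd_add (s t : Multiset ℕ) : psumProd (s + t) = psumProd s * psumProd t := by
  simp [psumProd]

/-- The symmetric functions that are homogeneous of degree `n`. -/
def Lam (n : ℕ) : Submodule ℂ (MvPowerSeries ℕ ℂ) :=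
  Submodule.span ℂ (Set.range fun lam : n.Partition => psumProd lam.parts)

lemma psumProd_mem_Lam {n : ℕ} {s : Multiset ℕ} (hs : ∀ i ∈ s, 0 < i) (hn : s.sum = n) :
    psumProd s ∈ Lam n :=
  Submodule.subset_span ⟨⟨s, fun {i} hi => hs i hi, hn⟩, rfl⟩

lemma one_mem_Lam : (1 : MvPowerSeries ℕ ℂ) ∈ Lam 0 := by
  have := psumProd_mem_Lam (s := 0) (n := 0) (by simp) (by simp)
  simpa [psumProd] using this

lemma psum_mem_Lam {k : ℕ} (hk : 0 < k) : psum k ∈ Lam k := by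
  have := psumProd_mem_Lam (s := {k}) (n := k) (by simpa using hk) (by simp)
  simpa [psumProd] using this

lemma mul_mem_Lam {m n : ℕ} {f g : MvPowerSeries ℕ ℂ} (hf : f ∈ Lam m) (hg : g ∈ Lam n) :
    f * g ∈ Lam (m + n) := by
  have h := Submodule.mul_mem_mul hf hg
  rw [Lam, Lam, Submodule.span_mul_span] at h
  refine Submodule.span_le.2 ?_ h
  rintro _ ⟨_, ⟨lam, rfl⟩, _, ⟨mu, rfl⟩, rfl⟩
  dsimp only
  rw [← psumProd_add]
  refine psumProd_mem_Lam (fun i hi => ?_) ?_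
  · rcases Multiset.mem_add.1 hi with hi | hi
    exacts [lam.parts_pos hi, mu.parts_pos hi]
  · rw [Multiset.sum_add, lam.parts_sum, mu.parts_sum]

lemma prod_mem_Lam {ι : Type*} {s : Finset ι} {f : ι → MvPowerSeries ℕ ℂ} {n : ι → ℕ}
    (h : ∀ i ∈ s, f i ∈ Lam (n i)) : ∏ i ∈ s, f i ∈ Lam (∑ i ∈ s, n i) := by
  classical
  induction s using Finset.induction_on with
  | empty => simpa using one_mem_Lam
  | insert a s ha ih =>
    rw [prod_insert ha, sum_insert ha]
    exact mul_mem_Lam (h a (mem_insert_self a s)) (ih fun i hi => h i (mem_insert_of_mem hi))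

lemma mem_of_natCast_succ_smul_mem {V : Type*} [AddCommGroup V] [Module ℂ V] {S : Submodule ℂ V}
    {m : ℕ} {v : V} (h : ((m + 1 : ℕ) : ℂ) • v ∈ S) : v ∈ S :=
  (S.smul_mem_iff (Nat.cast_ne_zero.2 m.succ_ne_zero)).1 h

lemma hsymm_mem_Lam (d : ℕ) : hsymm d ∈ Lam d := by
  induction d using Nat.strong_induction_on with
  | _ d ih =>
    rcases d with _ | m
    · rw [hsymm_zero]
      exact one_mem_Lam
    · refine mem_of_natCast_succ_smul_mem (m := m) ?_
      rw [newton_hsymm]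
      refine Submodule.sum_mem _ fun k hk => ?_
      rw [mem_range] at hk
      rw [show m + 1 = (k + 1) + (m - k) by omega]
      exact mul_mem_Lam (psum_mem_Lam k.succ_pos) (ih _ (by omega))

lemma esymm_mem_Lam (d : ℕ) : esymm d ∈ Lam d := by
  induction d using Nat.strong_induction_on with
  | _ d ih =>
    rcases d with _ | m
    · rw [esymm_zero]
      exact one_mem_Lam
    · refine mem_of_natCast_succ_smul_mem (m := m) ?_
      rw [newton_esymm]
      refine Submodule.sum_mem _ fun k hk => Submodule.smul_mem _ _ ?_
      rw [mem_range] at hk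
      rw [show m + 1 = (k + 1) + (m - k) by omega]
      exact mul_mem_Lam (psum_mem_Lam k.succ_pos) (ih _ (by omega))

lemma schur_mem_Lam {n : ℕ} (lam : n.Partition) : schur lam ∈ Lam n := by
  rw [schur_eq_sum]
  refine Submodule.sum_mem _ fun σ _ => Submodule.smul_mem _ _ ?_
  set ν : Fin (firstPart lam) → ℤ := fun i =>
    (conjPart lam (σ i) : ℤ) - ((σ i : ℕ) : ℤ) + ((i : ℕ) : ℤ) with hν
  by_cases hpos : ∀ i, 0 ≤ ν i
  · have hsum : ∑ i, (ν i).toNat = n := by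
      zify
      rw [sum_congr rfl fun i _ => Int.toNat_of_nonneg (hpos i)]
      simp only [hν, sum_add_distrib, sum_sub_distrib]
      rw [Equiv.sum_comp σ fun i => (conjPart lam i : ℤ),
        Equiv.sum_comp σ fun i : Fin (firstPart lam) => ((i : ℕ) : ℤ), ← Nat.cast_sum,
        sum_conjPart]
      ring
    have := prod_mem_Lam (s := univ) (f := fun i => esymmInt (ν i)) (n := fun i => (ν i).toNat)
      fun i _ => by
        rw [esymmInt, if_neg (hpos i).not_gt]
        exact esymm_mem_Lam _
    rwa [hsum] at this
  · push Not at hpos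
    obtain ⟨i, hi⟩ := hpos
    rw [prod_eq_zero (mem_univ i)]
    · exact zero_mem _
    · rw [esymmInt, if_pos hi]

/-! ### Comparison of the Schur functions with the power sum products. -/

/-- If a finite family spans the vectors of a linearly independent family with the same index
type, then it is linearly independent with the same span. -/
lemma linearIndependent_and_span_eq {ι V : Type*} [Fintype ι] [AddCommGroup V] [Module ℂ V]
    {s p : ι → V} (hs : LinearIndependent ℂ s)
    (h : ∀ i, s i ∈ Submodule.span ℂ (Set.range p)) :
    LinearIndependent ℂ p ∧ Submodule.span ℂ (Set.range s) = Submodule.span ℂ (Set.range p) := by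
  have hle : Submodule.span ℂ (Set.range s) ≤ Submodule.span ℂ (Set.range p) :=
    Submodule.span_le.2 (by rintro _ ⟨i, rfl⟩; exact h i)
  have h1 := finrank_span_eq_card hs
  have h2 : (Set.range p).finrank ℂ ≤ Fintype.card ι := finrank_range_le_card p
  have hfin : FiniteDimensional ℂ (Submodule.span ℂ (Set.range p)) :=
    FiniteDimensional.span_of_finite ℂ (Set.finite_range p)
  have h3 := Submodule.finrank_mono hle
  rw [Set.finrank] at h2
  refine ⟨linearIndependent_iff_card_eq_finrank_span.2 ?_,
    Submodule.eq_of_le_of_finrank_le hle (by omega)⟩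
  rw [Set.finrank]
  omega

lemma linearIndependent_schur_degree (n : ℕ) :
    LinearIndependent ℂ fun lam : n.Partition => schur lam :=
  linearIndependent_schur.comp (fun lam : n.Partition => (⟨n, lam⟩ : Σ n : ℕ, n.Partition))
    sigma_mk_injective

lemma span_schur (n : ℕ) :
    Submodule.span ℂ (Set.range fun lam : n.Partition => schur lam) = Lam n :=
  (linearIndependent_and_span_eq (linearIndependent_schur_degree n) schur_mem_Lam).2

/-- In degrees at most `N` there are as many power sum products as independent Schur functions, and
they span the latter. The truncation makes the index type finite, as the dimension count requires.
-/
lemma linearIndependent_psumProd :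
    LinearIndependent ℂ fun lam : Σ n : ℕ, n.Partition => psumProd lam.2.parts := by
  rw [linearIndependent_iff_finset_linearIndependent]
  intro s
  let N := s.sup fun lam => lam.1
  have hN : ∀ lam : s, lam.1.1 < N + 1 := fun lam =>
    Nat.lt_succ_of_le (le_sup (f := fun lam : Σ n : ℕ, n.Partition => lam.1) lam.2)
  have h1 : LinearIndependent ℂ fun lam : Σ n : Fin (N + 1), (n : ℕ).Partition =>
      schur lam.2 := by
    refine linearIndependent_schur.comp (fun lam : Σ n : Fin (N + 1), (n : ℕ).Partition =>
      (⟨lam.1, lam.2⟩ : Σ n : ℕ, n.Partition)) ?_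
    rintro ⟨⟨n, hn⟩, lam⟩ ⟨⟨m, hm⟩, mu⟩ h
    simp only [Sigma.mk.injEq] at h
    obtain ⟨rfl, h⟩ := h
    rw [eq_of_heq h]
  have h2 := (linearIndependent_and_span_eq (p := fun lam : Σ n : Fin (N + 1), (n : ℕ).Partition =>
    psumProd lam.2.parts) h1 fun lam => ?_).1
  · refine h2.comp (fun lam : s => (⟨⟨lam.1.1, hN lam⟩, lam.1.2⟩ :
      Σ n : Fin (N + 1), (n : ℕ).Partition)) ?_
    rintro ⟨⟨n, lam⟩, hlam⟩ ⟨⟨m, mu⟩, hmu⟩ h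
    simp only [Sigma.mk.injEq, Fin.mk.injEq] at h
    obtain ⟨rfl, h⟩ := h
    simp [eq_of_heq h]
  · refine Submodule.span_mono ?_ (schur_mem_Lam lam.2)
    rintro _ ⟨mu, rfl⟩
    exact ⟨⟨lam.1, mu⟩, rfl⟩

/-- The partition with `e k` parts equal to `k + 1`. -/
def expPartition (e : ℕ →₀ ℕ) : Σ n : ℕ, n.Partition :=
  ⟨_, ((Finsupp.toMultiset e).map (· + 1)), by
    intro i hi
    obtain ⟨k, -, rfl⟩ := Multiset.mem_map.1 hi
    exact k.succ_pos, rfl⟩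

lemma expPartition_injective : Function.Injective expPartition := by
  intro e e' h
  have h1 : (expPartition e).2.parts = (expPartition e').2.parts := by rw [h]
  exact Multiset.toFinsupp.symm.injective (Multiset.map_injective (add_left_injective 1) h1)

lemma psumProd_expPartition (e : ℕ →₀ ℕ) :
    psumProd (expPartition e).2.parts = ∏ k ∈ e.support, psum (k + 1) ^ e k := by
  simp only [psumProd, expPartition, Multiset.map_map]
  rw [Finsupp.toMultiset_map, Finsupp.prod_toMultiset, Finsupp.prod_mapDomain_index]
  · rfl
  · simp
  · intro _ _ _
    rw [pow_add]

/-- Distinct monomials go to distinct products `p_λ`, which are independent. Hence the `invFun` in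
`plethysm` recovers the polynomial in the power sums. -/
lemma evalPsum_injective : Function.Injective evalPsum := by
  rw [injective_iff_map_eq_zero]
  intro Q hQ
  rw [evalPsum, MvPolynomial.aeval_def, MvPolynomial.eval₂_eq] at hQ
  simp only [← psumProd_expPartition] at hQ
  have h := linearIndependent_iff'.1
    (linearIndependent_psumProd.comp _ expPartition_injective) Q.support (fun e => Q.coeff e) (by
      simpa [Algebra.smul_def] using hQ)
  ext e
  by_cases he : e ∈ Q.support
  · exact h e he
  · exact MvPolynomial.notMem_support_iff.1 he

lemma psumProd_mem_range {s : Multiset ℕ} (hs : ∀ i ∈ s, 0 < i) :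
    psumProd s ∈ evalPsum.range := by
  refine multiset_prod_mem _ fun f hf => ?_
  obtain ⟨i, hi, rfl⟩ := Multiset.mem_map.1 hf
  refine ⟨MvPolynomial.X (i - 1), ?_⟩
  change MvPolynomial.aeval _ _ = _
  rw [MvPolynomial.aeval_X, Nat.sub_add_cancel (hs i hi)]

lemma Lam_le_range (n : ℕ) : Lam n ≤ Subalgebra.toSubmodule evalPsum.range :=
  Submodule.span_le.2 (by
    rintro _ ⟨lam, rfl⟩
    exact psumProd_mem_range fun i hi => lam.parts_pos hi)

lemma degree_eq_of_mem_Lam {n : ℕ} {f : MvPowerSeries ℕ ℂ} (hf : f ∈ Lam n) {a : ℕ →₀ ℕ}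
    (ha : coeff a f ≠ 0) : a.degree = n := by
  classical
  have hprod : ∀ (s : Multiset ℕ) (a : ℕ →₀ ℕ), coeff a (psumProd s) ≠ 0 → a.degree = s.sum := by
    intro s
    induction s using Multiset.induction_on with
    | empty =>
      intro a ha
      have : a = 0 := by
        by_contra h
        simp [psumProd, coeff_one, h] at ha
      simp [this]
    | cons k s ih =>
      intro a ha
      have h1 : psumProd (k ::ₘ s) = psum k * psumProd s := by simp [psumProd]
      rw [h1, coeff_mul] at ha
      obtain ⟨p, hp, hne⟩ := exists_ne_zero_of_sum_ne_zero ha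
      rw [HasAntidiagonal.mem_antidiagonal] at hp
      have h2 := ih _ (right_ne_zero_of_mul hne)
      have h3 := left_ne_zero_of_mul hne
      rw [coeff_psum] at h3
      obtain ⟨i, hi⟩ : ∃ i, p.1 = Finsupp.single i k := by
        by_contra h
        exact h3 (if_neg h)
      rw [← hp, map_add, h2, hi, Finsupp.degree_single, Multiset.sum_cons]
  induction hf using Submodule.span_induction with
  | mem f hf =>
    obtain ⟨lam, rfl⟩ := hf
    rw [hprod _ _ ha, lam.parts_sum]
  | zero => simp at ha
  | add f g _ _ ihf ihg =>
    by_cases h : coeff a f = 0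
    · exact ihg (by rwa [map_add, h, zero_add] at ha)
    · exact ihf h
  | smul c f _ ih =>
    rw [coeff_smul] at ha
    exact ih (right_ne_zero_of_mul ha)

/-! ### Boundedness in terms of exponents -/

lemma boundedBy_of_expLE {n N : ℕ} {f : MvPowerSeries ℕ ℂ} (hf : f ∈ Lam n) (h : ExpLE f N) :
    BoundedBy f N := by
  have hmem : f ∈ Submodule.span ℂ (Set.range fun lam : Σ n : ℕ, n.Partition => schur lam.2) := by
    rw [← span_schur] at hf
    refine Submodule.span_mono ?_ hf
    rintro _ ⟨lam, rfl⟩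
    exact ⟨⟨n, lam⟩, rfl⟩
  obtain ⟨c, rfl⟩ := Finsupp.mem_span_range_iff_exists_finsupp.1 hmem
  exact ⟨c, isSchurExpansion c, fun lam hlam => firstPart_le_of_expLE h hlam⟩

lemma BoundedBy.expLE {N : ℕ} {f : MvPowerSeries ℕ ℂ} (h : BoundedBy f N) : ExpLE f N := by
  obtain ⟨c, hc, hN⟩ := h
  rw [← (hc c).2 rfl, schurSum]
  refine ExpLE.sum fun lam hlam => ExpLE.smul ?_ _
  exact (expLE_schur lam.2).mono (hN lam (Finsupp.mem_support_iff.1 hlam))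

/-- One monomial with an exponent equal to `N` excludes every smaller bound. -/
lemma sharplyBoundedBy_of_expLE {n N : ℕ} {f : MvPowerSeries ℕ ℂ} (hf : f ∈ Lam n)
    (h : ExpLE f N) {a : ℕ →₀ ℕ} (ha : coeff a f ≠ 0) {i : ℕ} (hi : a i = N) :
    SharplyBoundedBy f N :=
  ⟨boundedBy_of_expLE hf h, fun _ hM => hi ▸ hM.expLE a ha i⟩

lemma exists_sum_schur {n : ℕ} {f : MvPowerSeries ℕ ℂ} (hf : f ∈ Lam n) :
    ∃ c : n.Partition → ℂ, ∑ lam, c lam • schur lam = f := by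
  rw [← span_schur] at hf
  exact (Submodule.mem_span_range_iff_exists_fun ℂ).1 hf

lemma sum_schur_injective {n : ℕ} {c c' : n.Partition → ℂ}
    (h : ∑ lam, c lam • schur lam = ∑ lam, c' lam • schur lam) : c = c' := by
  refine funext fun lam => sub_eq_zero.1 ?_
  refine Fintype.linearIndependent_iff.1 (linearIndependent_schur_degree n)
    (fun lam => c lam - c' lam) ?_ lam
  simp only [sub_smul, sum_sub_distrib, h, sub_self]

lemma firstPart_le_of_expLE_sum {n N : ℕ} {c : n.Partition → ℂ}
    (h : ExpLE (∑ lam, c lam • schur lam) N) {lam : n.Partition} (hlam : c lam ≠ 0) :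
    firstPart lam ≤ N := by
  classical
  let c' : (Σ n : ℕ, n.Partition) →₀ ℂ :=
    (Finsupp.equivFunOnFinite.symm c).mapDomain fun lam => ⟨n, lam⟩
  have hsum : schurSum c' = ∑ lam, c lam • schur lam := by
    rw [schurSum_eq_linearCombination, Finsupp.linearCombination_mapDomain,
      Finsupp.linearCombination_apply, Finsupp.sum_fintype]
    · rfl
    · simp
  have hc' : c' ⟨n, lam⟩ = c lam :=
    Finsupp.mapDomain_apply sigma_mk_injective (Finsupp.equivFunOnFinite.symm c) lam
  exact firstPart_le_of_expLE (c := c') (hsum ▸ h) (lam := ⟨n, lam⟩) (by rwa [hc'])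

/-! ### Plethysm -/

lemma plethysm_evalPsum (Q : MvPolynomial ℕ ℂ) (g : MvPowerSeries ℕ ℂ) :
    plethysm (evalPsum Q) g =
      MvPolynomial.aeval (fun k => expand (k + 1) k.succ_ne_zero g) Q := by
  rw [plethysm, Function.leftInverse_invFun evalPsum_injective]

lemma plethysm_one (g : MvPowerSeries ℕ ℂ) : plethysm 1 g = 1 := by
  have := plethysm_evalPsum 1 g
  rwa [map_one, map_one] at this

lemma plethysm_psum_mul (k : ℕ) {f : MvPowerSeries ℕ ℂ} (hf : f ∈ evalPsum.range)
    (g : MvPowerSeries ℕ ℂ) :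
    plethysm (psum (k + 1) * f) g = expand (k + 1) k.succ_ne_zero g * plethysm f g := by
  obtain ⟨Q, rfl⟩ := hf
  have h : psum (k + 1) = evalPsum (MvPolynomial.X k) := by simp [evalPsum]
  change plethysm (_ * evalPsum Q) g = _ * plethysm (evalPsum Q) g
  rw [h, ← map_mul, plethysm_evalPsum, plethysm_evalPsum, map_mul, MvPolynomial.aeval_X]

lemma plethysm_smul (c : ℂ) {f : MvPowerSeries ℕ ℂ} (hf : f ∈ evalPsum.range)
    (g : MvPowerSeries ℕ ℂ) : plethysm (c • f) g = c • plethysm f g := by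
  obtain ⟨Q, rfl⟩ := hf
  change plethysm (c • evalPsum Q) g = c • plethysm (evalPsum Q) g
  rw [← map_smul, plethysm_evalPsum, plethysm_evalPsum, map_smul]

lemma plethysm_sum {ι : Type*} (s : Finset ι) {f : ι → MvPowerSeries ℕ ℂ}
    (hf : ∀ i ∈ s, f i ∈ evalPsum.range) (g : MvPowerSeries ℕ ℂ) :
    plethysm (∑ i ∈ s, f i) g = ∑ i ∈ s, plethysm (f i) g := by
  choose! Q hQ using hf
  have hQ' : ∀ i ∈ s, evalPsum (Q i) = f i := hQ
  rw [← sum_congr rfl hQ', ← map_sum, plethysm_evalPsum, map_sum]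
  exact sum_congr rfl fun i hi => by rw [← plethysm_evalPsum, hQ' i hi]

lemma hsymm_mem_range (d : ℕ) : hsymm d ∈ evalPsum.range := Lam_le_range d (hsymm_mem_Lam d)

lemma esymm_mem_range (d : ℕ) : esymm d ∈ evalPsum.range := Lam_le_range d (esymm_mem_Lam d)

lemma psum_mem_range (k : ℕ) : psum (k + 1) ∈ evalPsum.range :=
  Lam_le_range _ (psum_mem_Lam k.succ_pos)

lemma expand_psum {k : ℕ} (hk : k ≠ 0) (j : ℕ) : expand k hk (psum j) = psum (k * j) := by
  classical
  ext a
  by_cases h : ∀ i, k ∣ a i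
  · obtain ⟨b, rfl⟩ := exists_eq_smul_of_forall_dvd h
    rw [coeff_expand_smul, coeff_psum, coeff_psum]
    refine if_congr (exists_congr fun i => ?_) rfl rfl
    rw [← smul_eq_mul, ← Finsupp.smul_single]
    exact (smul_right_injective _ hk).eq_iff.symm
  · push Not at h
    obtain ⟨i, hi⟩ := h
    rw [coeff_expand_of_not_dvd k hk _ hi, coeff_psum, if_neg]
    rintro ⟨l, rfl⟩
    rw [Finsupp.single_apply] at hi
    split_ifs at hi
    · exact hi (dvd_mul_right k j)
    · exact hi (dvd_zero k)

lemma expand_mem_Lam {k : ℕ} (hk : k ≠ 0) {d : ℕ} {g : MvPowerSeries ℕ ℂ} (hg : g ∈ Lam d) :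
    expand k hk g ∈ Lam (k * d) := by
  induction hg using Submodule.span_induction with
  | mem g hg =>
    obtain ⟨lam, rfl⟩ := hg
    dsimp only
    have : expand k hk (psumProd lam.parts) = psumProd (lam.parts.map (k * ·)) := by
      rw [psumProd, map_multiset_prod, psumProd, Multiset.map_map, Multiset.map_map]
      simp only [Function.comp_def, expand_psum]
    rw [this]
    refine psumProd_mem_Lam (fun i hi => ?_) ?_
    · obtain ⟨j, hj, rfl⟩ := Multiset.mem_map.1 hi
      exact Nat.mul_pos (Nat.pos_of_ne_zero hk) (lam.parts_pos hj)
    · rw [Multiset.sum_map_mul_left, Multiset.map_id', lam.parts_sum]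
  | zero => simp
  | add f g _ _ hf hg =>
    rw [map_add]
    exact add_mem hf hg
  | smul c g _ hg =>
    rw [map_smul]
    exact Submodule.smul_mem _ _ hg

/-! ### Newton recursions -/

/-- The sequence `H` satisfies `H_0 = 1` and `(m + 1) H_{m+1} = ∑ c ^ k p_k H_{m-k}`. -/
def IsNewton (c : ℂ) (p H : ℕ → MvPowerSeries ℕ ℂ) : Prop :=
  H 0 = 1 ∧ ∀ m, ((m + 1 : ℕ) : ℂ) • H (m + 1) = ∑ k ∈ range (m + 1), c ^ k • (p k * H (m - k))

lemma isNewton_plethysm_hsymm (g : MvPowerSeries ℕ ℂ) :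
    IsNewton 1 (fun k => expand (k + 1) k.succ_ne_zero g) (fun m => plethysm (hsymm m) g) := by
  refine ⟨by simp only [hsymm_zero, plethysm_one], fun m => ?_⟩
  rw [← plethysm_smul _ (hsymm_mem_range _), newton_hsymm, plethysm_sum _ fun k _ =>
    mul_mem (psum_mem_range k) (hsymm_mem_range _)]
  exact sum_congr rfl fun k _ => by
    rw [plethysm_psum_mul k (hsymm_mem_range _), one_pow, one_smul]

lemma isNewton_plethysm_esymm (g : MvPowerSeries ℕ ℂ) :
    IsNewton (-1) (fun k => expand (k + 1) k.succ_ne_zero g) (fun m => plethysm (esymm m) g) := by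
  refine ⟨by simp only [esymm_zero, plethysm_one], fun m => ?_⟩
  have hmem := fun k : ℕ => mul_mem (psum_mem_range k) (esymm_mem_range (m - k))
  rw [← plethysm_smul _ (esymm_mem_range _), newton_esymm, plethysm_sum _ fun k _ =>
    Subalgebra.smul_mem _ (hmem k) _]
  exact sum_congr rfl fun k _ => by
    rw [plethysm_smul _ (hmem k), plethysm_psum_mul k (esymm_mem_range _)]

namespace IsNewton

variable {c : ℂ} {p q H K : ℕ → MvPowerSeries ℕ ℂ}

/-- The entry `p k` plays the role of the power sum of index `k + 1`, so every term `p k * H (m -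
k)` has the same total bound `(m + 1) * N`. -/
lemma expLE {N : ℕ} (h : IsNewton c p H) (hp : ∀ k, ExpLE (p k) ((k + 1) * N)) (m : ℕ) :
    ExpLE (H m) (m * N) := by
  induction m using Nat.strong_induction_on with
  | _ m ih =>
    rcases m with _ | m
    · rw [h.1]
      exact ExpLE.one _
    · intro a ha
      have hs : ExpLE (((m + 1 : ℕ) : ℂ) • H (m + 1)) ((m + 1) * N) := by
        rw [h.2]
        refine ExpLE.sum fun k hk => ExpLE.smul ?_ _
        rw [mem_range] at hk
        rw [show m + 1 = (k + 1) + (m - k) by omega, add_mul]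
        exact (hp k).mul (ih _ (by omega))
      refine hs a ?_
      rw [coeff_smul]
      exact mul_ne_zero (Nat.cast_ne_zero.2 m.succ_ne_zero) ha

lemma mem_Lam {d : ℕ} (h : IsNewton c p H) (hp : ∀ k, p k ∈ Lam ((k + 1) * d)) (m : ℕ) :
    H m ∈ Lam (m * d) := by
  induction m using Nat.strong_induction_on with
  | _ m ih =>
    rcases m with _ | m
    · rw [h.1, zero_mul]
      exact one_mem_Lam
    · refine mem_of_natCast_succ_smul_mem (m := m) ?_
      rw [h.2]
      refine Submodule.sum_mem _ fun k hk => Submodule.smul_mem _ _ ?_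
      rw [mem_range] at hk
      rw [show m + 1 = (k + 1) + (m - k) by omega, add_mul]
      exact mul_mem_Lam (hp k) (ih _ (by omega))

lemma unique (hH : IsNewton c p H) (hK : IsNewton c p K) (m : ℕ) : H m = K m := by
  induction m using Nat.strong_induction_on with
  | _ m ih =>
    rcases m with _ | m
    · rw [hH.1, hK.1]
    · have : ((m + 1 : ℕ) : ℂ) • H (m + 1) = ((m + 1 : ℕ) : ℂ) • K (m + 1) := by
        rw [hH.2, hK.2]
        refine sum_congr rfl fun k hk => ?_
        rw [ih (m - k) (by omega)]
      exact smul_right_injective _ (Nat.cast_ne_zero.2 m.succ_ne_zero) this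

/-- In terms of generating series the recursion is the differential equation `H' = P H`. -/
lemma iff_derivative : IsNewton c p H ↔ H 0 = 1 ∧
    PowerSeries.derivative (MvPowerSeries ℕ ℂ) (PowerSeries.mk H) =
      PowerSeries.mk (fun k => c ^ k • p k) * PowerSeries.mk H := by
  refine and_congr_right fun _ => ?_
  rw [PowerSeries.ext_iff]
  refine forall_congr' fun m => ?_
  rw [PowerSeries.coeff_mul, Nat.sum_antidiagonal_eq_sum_range_succ_mk]
  simp only [PowerSeries.coeff_derivative, PowerSeries.coeff_mk,
    smul_mul_assoc]
  have : ((m + 1 : ℕ) : ℂ) • H (m + 1) = H (m + 1) * ((m : MvPowerSeries ℕ ℂ) + 1) := by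
    rw [Nat.cast_smul_eq_nsmul, nsmul_eq_mul, mul_comm]
    push_cast
    rfl
  rw [this]

/-- The product of two solutions of `H' = P H` solves the equation for the sum of the coefficient
series, by Leibniz. This yields the expansion of `e_m[f + g]`. -/
lemma convolution (hH : IsNewton c p H) (hK : IsNewton c q K) :
    IsNewton c (fun k => p k + q k) fun m => ∑ i ∈ antidiagonal m, H i.1 * K i.2 := by
  rw [iff_derivative] at hH hK ⊢
  have hmul : PowerSeries.mk (fun m => ∑ i ∈ antidiagonal m, H i.1 * K i.2) =
      PowerSeries.mk H * PowerSeries.mk K := by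
    ext1 m
    rw [PowerSeries.coeff_mul]
    simp
  have hadd : PowerSeries.mk (fun k => c ^ k • (p k + q k)) =
      PowerSeries.mk (fun k => c ^ k • p k) + PowerSeries.mk (fun k => c ^ k • q k) := by
    ext1 m
    simp
  refine ⟨by simp [hH.1, hK.1], ?_⟩
  rw [hmul, hadd, Derivation.leibniz, hH.2, hK.2]
  simp only [smul_eq_mul]
  ring

end IsNewton

lemma expLE_plethysm_hsymm {g : MvPowerSeries ℕ ℂ} {N : ℕ} (hg : ExpLE g N) (m : ℕ) :
    ExpLE (plethysm (hsymm m) g) (m * N) :=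
  (isNewton_plethysm_hsymm g).expLE (fun k => hg.expand k.succ_ne_zero) m

lemma expLE_plethysm_esymm {g : MvPowerSeries ℕ ℂ} {N : ℕ} (hg : ExpLE g N) (m : ℕ) :
    ExpLE (plethysm (esymm m) g) (m * N) :=
  (isNewton_plethysm_esymm g).expLE (fun k => hg.expand k.succ_ne_zero) m

lemma plethysm_hsymm_mem_Lam {g : MvPowerSeries ℕ ℂ} {d : ℕ} (hg : g ∈ Lam d) (m : ℕ) :
    plethysm (hsymm m) g ∈ Lam (m * d) :=
  (isNewton_plethysm_hsymm g).mem_Lam (fun k => expand_mem_Lam k.succ_ne_zero hg) m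

lemma plethysm_esymm_mem_Lam {g : MvPowerSeries ℕ ℂ} {d : ℕ} (hg : g ∈ Lam d) (m : ℕ) :
    plethysm (esymm m) g ∈ Lam (m * d) :=
  (isNewton_plethysm_esymm g).mem_Lam (fun k => expand_mem_Lam k.succ_ne_zero hg) m

/-! ### The plethysm `h_m[e_2]` -/

open scoped ComplexOrder

/-- All coefficients of `f` are nonnegative real numbers. -/
def NonnegCoeff (f : MvPowerSeries ℕ ℂ) : Prop := ∀ a, 0 ≤ coeff a f

lemma NonnegCoeff.mul {f g : MvPowerSeries ℕ ℂ} (hf : NonnegCoeff f) (hg : NonnegCoeff g) :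
    NonnegCoeff (f * g) := fun a => by
  rw [coeff_mul]
  exact sum_nonneg fun p _ => mul_nonneg (hf _) (hg _)

lemma NonnegCoeff.expand {f : MvPowerSeries ℕ ℂ} (hf : NonnegCoeff f) {k : ℕ} (hk : k ≠ 0) :
    NonnegCoeff (expand k hk f) := fun a => by
  by_cases h : ∀ i, k ∣ a i
  · obtain ⟨b, rfl⟩ := exists_eq_smul_of_forall_dvd h
    rw [coeff_expand_smul]
    exact hf b
  · push Not at h
    obtain ⟨i, hi⟩ := h
    rw [coeff_expand_of_not_dvd k hk _ hi]

lemma nonnegCoeff_esymm (d : ℕ) : NonnegCoeff (esymm d) := fun a => by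
  classical
  rw [coeff_esymm]
  split_ifs
  · exact zero_le_one
  · exact le_rfl

lemma IsNewton.nonnegCoeff {p H : ℕ → MvPowerSeries ℕ ℂ} (h : IsNewton 1 p H)
    (hp : ∀ k, NonnegCoeff (p k)) (m : ℕ) : NonnegCoeff (H m) := by
  induction m using Nat.strong_induction_on with
  | _ m ih =>
    rcases m with _ | m
    · intro a
      rw [h.1, coeff_one]
      split_ifs
      · exact zero_le_one
      · exact le_rfl
    · intro a
      have h1 : 0 ≤ coeff a (((m + 1 : ℕ) : ℂ) • H (m + 1)) := by
        rw [h.2, map_sum]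
        refine sum_nonneg fun k _ => ?_
        rw [one_pow, one_smul]
        exact (hp k).mul (ih _ (by omega)) a
      rw [coeff_smul] at h1
      have hpos : (0 : ℂ) < ((m + 1 : ℕ) : ℂ) := Nat.cast_pos.2 m.succ_pos
      exact le_of_mul_le_mul_left (by rwa [mul_zero]) hpos

/-- With `c = 1` nothing in the recursion cancels, so it is enough to keep the term `k = 0` and the
splitting `x_0 x_1 · x_0^m x_1^m`. -/
lemma coeff_plethysm_hsymm_esymm_two_pos (m : ℕ) :
    0 < coeff (Finsupp.single 0 m + Finsupp.single 1 m) (plethysm (hsymm m) (esymm 2)) := by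
  classical
  have hN := isNewton_plethysm_hsymm (esymm 2)
  have hnn := hN.nonnegCoeff fun k => (nonnegCoeff_esymm 2).expand k.succ_ne_zero
  induction m with
  | zero => simp [hsymm_zero, plethysm_one]
  | succ m ih =>
    set a := Finsupp.single 0 (m + 1) + Finsupp.single 1 (m + 1) with ha
    have hterm : ∀ k, 0 ≤ coeff a (expand (k + 1) k.succ_ne_zero (esymm 2) *
        plethysm (hsymm (m - k)) (esymm 2)) := fun k =>
      ((nonnegCoeff_esymm 2).expand k.succ_ne_zero).mul (hnn _) a
    have h1 : 0 < coeff a (((m + 1 : ℕ) : ℂ) • plethysm (hsymm (m + 1)) (esymm 2)) := by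
      rw [hN.2, map_sum]
      simp only [one_pow, one_smul]
      refine lt_of_lt_of_le ?_ (single_le_sum (fun k _ => hterm k) (mem_range.2 m.succ_pos))
      rw [coeff_mul]
      refine lt_of_lt_of_le ?_ (single_le_sum (fun p _ => mul_nonneg
        (((nonnegCoeff_esymm 2).expand one_ne_zero) p.1) (hnn _ p.2))
        (a := (Finsupp.single 0 1 + Finsupp.single 1 1, Finsupp.single 0 m + Finsupp.single 1 m))
        ?_)
      · rw [expand_one_apply, coeff_esymm, if_pos, one_mul]
        · exact ih
        · refine ⟨by simp, fun i => ?_⟩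
          simp only [Finsupp.add_apply, Finsupp.single_apply]
          split_ifs <;> omega
      · rw [HasAntidiagonal.mem_antidiagonal, ha]
        ext i
        simp only [Finsupp.add_apply, Finsupp.single_apply]
        split_ifs <;> omega
    rw [coeff_smul] at h1
    have hpos : (0 : ℂ) < ((m + 1 : ℕ) : ℂ) := Nat.cast_pos.2 m.succ_pos
    exact pos_of_mul_pos_right h1 hpos.le

lemma coeff_plethysm_hsymm_esymm_two_ne_zero (m : ℕ) :
    coeff (Finsupp.single 0 m + Finsupp.single 1 m) (plethysm (hsymm m) (esymm 2)) ≠ 0 :=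
  (coeff_plethysm_hsymm_esymm_two_pos m).ne'

lemma sharplyBoundedBy_plethysm_hsymm_esymm_two (m : ℕ) :
    SharplyBoundedBy (plethysm (hsymm m) (esymm 2)) m := by
  have h := expLE_plethysm_hsymm (expLE_esymm 2) m
  rw [mul_one] at h
  exact sharplyBoundedBy_of_expLE (plethysm_hsymm_mem_Lam (esymm_mem_Lam 2) m) h
    (coeff_plethysm_hsymm_esymm_two_ne_zero m) (i := 0) (by simp)

/-! ### The plethysm `e_m[h_2]` -/

lemma hsymm_two : hsymm 2 = esymm 2 + psum 2 := by
  have h1 := newton_hsymm 0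
  have h2 := newton_hsymm 1
  have e1 := newton_esymm 0
  have e2 := newton_esymm 1
  simp only [sum_range_succ, range_zero, sum_empty, zero_add, Nat.sub_self, hsymm_zero,
    esymm_zero, Nat.cast_one, one_smul, pow_zero, pow_one, mul_one, Nat.sub_zero,
    neg_smul] at h1 h2 e1 e2
  norm_num at h1 h2 e1 e2
  have h3 : (2 : ℂ) • hsymm 2 = (2 : ℂ) • (esymm 2 + psum 2) := by
    rw [h2, smul_add, e2, h1, e1, two_smul]
    ring
  exact smul_right_injective _ (two_ne_zero' ℂ) h3

/-- Both sides satisfy the same Newton recursion, since `p_k[p_2] = p_2[p_k] = p_(2k)`. -/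
lemma plethysm_esymm_psum_two (m : ℕ) :
    plethysm (esymm m) (psum 2) = expand 2 two_ne_zero (esymm m) := by
  refine (isNewton_plethysm_esymm (psum 2)).unique (K := fun m => expand 2 two_ne_zero (esymm m))
    ⟨by simp only [esymm_zero, map_one], fun m => ?_⟩ m
  rw [← map_smul, newton_esymm, map_sum]
  refine sum_congr rfl fun k _ => ?_
  simp only [map_smul, map_mul, expand_psum, mul_comm 2 (k + 1)]

lemma plethysm_esymm_hsymm_two (m : ℕ) :
    plethysm (esymm m) (hsymm 2) = ∑ i ∈ antidiagonal m,
      plethysm (esymm i.1) (esymm 2) * expand 2 two_ne_zero (esymm i.2) := by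
  have h := (isNewton_plethysm_esymm (esymm 2)).convolution (isNewton_plethysm_esymm (psum 2))
  simp only [plethysm_esymm_psum_two, ← map_add, ← hsymm_two] at h
  exact (isNewton_plethysm_esymm (hsymm 2)).unique h m

lemma expLE_plethysm_esymm_esymm_two (m : ℕ) : ExpLE (plethysm (esymm m) (esymm 2)) m := by
  simpa using expLE_plethysm_esymm (expLE_esymm 2) m

/-- For `j = 0` the second factor is 1 and costs nothing. Separating this case improves the bound
for `e_m[h_2]` from `m + 2` to `m + 1`. -/
lemma expLE_plethysm_esymm_mul (i j : ℕ) :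
    ExpLE (plethysm (esymm i) (esymm 2) * expand 2 two_ne_zero (esymm j))
      (if j = 0 then i else i + 2) := by
  split_ifs with h
  · rw [h, esymm_zero, map_one, mul_one]
    exact expLE_plethysm_esymm_esymm_two i
  · exact (expLE_plethysm_esymm_esymm_two i).mul ((expLE_esymm j).expand two_ne_zero)

lemma expLE_plethysm_esymm_hsymm_two (m : ℕ) : ExpLE (plethysm (esymm m) (hsymm 2)) (m + 1) := by
  rw [plethysm_esymm_hsymm_two]
  refine ExpLE.sum fun i hi => (expLE_plethysm_esymm_mul i.1 i.2).mono ?_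
  rw [HasAntidiagonal.mem_antidiagonal] at hi
  split_ifs <;> omega

/-- The exponent vector of `x_0 ^ j * ∏_{s ∈ S} x_s`. -/
def hook (S : Finset ℕ) (j : ℕ) : ℕ →₀ ℕ := Finsupp.single 0 j + ∑ s ∈ S, Finsupp.single s 1

lemma hook_apply (S : Finset ℕ) (j i : ℕ) :
    hook S j i = (if i = 0 then j else 0) + if i ∈ S then 1 else 0 := by
  simp [hook, Finsupp.single_apply, eq_comm]

lemma add_hook_erase {S : Finset ℕ} {s : ℕ} (hs : s ∈ S) (m : ℕ) :
    (Finsupp.single 0 1 + Finsupp.single s 1) + hook (S.erase s) m = hook S (m + 1) := by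
  rw [hook, hook, ← add_sum_erase S _ hs, Finsupp.single_add]
  abel

lemma exists_eq_single_of_degree_eq_one {a : ℕ →₀ ℕ} (h : a.degree = 1) :
    ∃ i, a = Finsupp.single i 1 := by
  obtain ⟨i, hi⟩ : ∃ i, a i ≠ 0 := by
    by_contra! h0
    have : a = 0 := Finsupp.ext h0
    simp [this] at h
  have h1 : 1 ≤ a i := Nat.one_le_iff_ne_zero.2 hi
  have h2 := degree_sub_single h1
  rw [h, Nat.add_eq_right, Finsupp.degree_eq_zero_iff] at h2
  exact ⟨i, le_antisymm (tsub_eq_zero_iff_le.1 h2) (Finsupp.single_le_iff.2 h1)⟩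

/-- The monomials of `p_k[e_2]` are `x_s^k x_t^k` with `s ≠ t`, but in a hook only `x_0` can have an
exponent of 2 or more. -/
lemma coeff_hook_expand_mul (S : Finset ℕ) (j : ℕ) {k : ℕ} (hk : 2 ≤ k)
    (f : MvPowerSeries ℕ ℂ) :
    coeff (hook S j) (expand k (by omega) (esymm 2) * f) = 0 := by
  rw [coeff_mul]
  refine sum_eq_zero fun p hp => ?_
  rw [HasAntidiagonal.mem_antidiagonal] at hp
  by_contra hne
  have hne := left_ne_zero_of_mul hne
  have hdeg := degree_eq_of_mem_Lam (expand_mem_Lam (by omega) (esymm_mem_Lam 2)) hne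
  have hle := (expLE_esymm 2).expand (by omega) _ hne 0
  have hp1 : p.1 = Finsupp.single 0 (p.1 0) := by
    ext i
    by_cases hi : i = 0
    · simp [hi]
    · rw [Finsupp.single_eq_of_ne hi]
      by_contra hpi
      have hdvd : k ∣ p.1 i := by
        by_contra h
        exact hne (coeff_expand_of_not_dvd k _ _ h)
      have h1 := Nat.le_of_dvd (Nat.pos_of_ne_zero hpi) hdvd
      have h2 : p.1 i + p.2 i = hook S j i := by rw [← hp, Finsupp.add_apply]
      rw [hook_apply, if_neg hi] at h2
      split_ifs at h2 <;> omega
  rw [hp1, Finsupp.degree_single] at hdeg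
  omega

/-- Since `f` supplies at most `x_0^m`, the factor `e_2` must supply `x_0`, hence a monomial `x_0
x_s` with `s ∈ S`. -/
lemma coeff_hook_esymm_two_mul {S : Finset ℕ} (h0 : 0 ∉ S) {m : ℕ} {f : MvPowerSeries ℕ ℂ}
    (hf : ExpLE f m) : coeff (hook S (m + 1)) (esymm 2 * f) =
      ∑ s ∈ S, coeff (hook (S.erase s) m) f := by
  classical
  rw [coeff_mul]
  symm
  refine sum_of_injOn (fun s => (Finsupp.single 0 1 + Finsupp.single s 1, hook (S.erase s) m))
    ?_ ?_ ?_ ?_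
  · intro s _ t _ hst
    exact (Finsupp.single_left_inj one_ne_zero).1 (add_left_cancel (congrArg Prod.fst hst))
  · intro s hs
    rw [mem_coe, HasAntidiagonal.mem_antidiagonal]
    exact add_hook_erase hs m
  · rintro ⟨p, q⟩ hp hni
    rw [HasAntidiagonal.mem_antidiagonal] at hp
    dsimp only at hp ⊢
    by_contra hne
    have hq := hf _ (right_ne_zero_of_mul hne) 0
    have hp0 := expLE_esymm 2 _ (left_ne_zero_of_mul hne)
    have hdeg := degree_eq_of_mem_Lam (esymm_mem_Lam 2) (left_ne_zero_of_mul hne)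
    have happ : ∀ i, p i + q i = hook S (m + 1) i := fun i => by rw [← hp, Finsupp.add_apply]
    have h1 : p 0 = 1 := by
      have h2 := happ 0
      have h3 := hp0 0
      rw [hook_apply, if_pos rfl, if_neg h0] at h2
      omega
    have h2 := degree_sub_single h1.ge
    obtain ⟨s, hs⟩ := exists_eq_single_of_degree_eq_one (a := p - Finsupp.single 0 1) (by omega)
    have hps : p = Finsupp.single 0 1 + Finsupp.single s 1 := by
      rw [← hs, add_tsub_cancel_of_le (Finsupp.single_le_iff.2 h1.ge)]
    have hs0 : s ≠ 0 := by
      rintro rfl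
      rw [hps] at h1
      simp at h1
    have hsS : s ∈ S := by
      by_contra hsS
      have h3 := happ s
      rw [hook_apply, if_neg hs0, if_neg hsS, hps, Finsupp.add_apply, Finsupp.single_eq_same] at h3
      omega
    refine hni ⟨s, hsS, Prod.ext hps.symm ?_⟩
    rw [← add_hook_erase hsS m, hps] at hp
    exact (add_left_cancel hp).symm
  · intro s hs
    have hs0 : s ≠ 0 := fun h => h0 (h ▸ hs)
    rw [coeff_esymm, if_pos, one_mul]
    refine ⟨by simp, fun i => ?_⟩
    simp only [Finsupp.add_apply, Finsupp.single_apply]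
    split_ifs <;> omega

/-- Only `k = 0` survives in the recursion; it gives `m + 1` coefficients equal to 1, and the factor
`m + 1` on the left cancels them. -/
lemma coeff_hook_plethysm_esymm_esymm_two (m : ℕ) : ∀ {S : Finset ℕ}, 0 ∉ S → #S = m →
    coeff (hook S m) (plethysm (esymm m) (esymm 2)) = 1 := by
  classical
  induction m with
  | zero =>
    intro S _ hS
    rw [esymm_zero, plethysm_one, card_eq_zero.1 hS]
    simp [hook]
  | succ m ih =>
    intro S h0 hS
    have h := congrArg (coeff (hook S (m + 1))) ((isNewton_plethysm_esymm (esymm 2)).2 m)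
    rw [coeff_smul, map_sum, sum_eq_single 0] at h
    · simp only [pow_zero, one_smul, zero_add, expand_one_apply, Nat.sub_zero] at h
      rw [coeff_hook_esymm_two_mul h0 (expLE_plethysm_esymm_esymm_two m),
        sum_congr rfl fun s hs => ih (fun h => h0 (mem_of_mem_erase h)) (by
          rw [card_erase_of_mem hs, hS, Nat.add_sub_cancel]), sum_const, hS, nsmul_one] at h
      exact mul_left_cancel₀ (Nat.cast_ne_zero.2 m.succ_ne_zero) (by rw [h, mul_one])
    · intro k _ hk
      rw [coeff_smul, coeff_hook_expand_mul S (m + 1) (by omega), mul_zero]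
    · simp

lemma exists_coeff_plethysm_esymm_hsymm_two_ne_zero {m : ℕ} (hm : 1 ≤ m) :
    ∃ a : ℕ →₀ ℕ, coeff a (plethysm (esymm m) (hsymm 2)) ≠ 0 ∧ a 0 = m + 1 := by
  obtain ⟨j, rfl⟩ : ∃ j, m = j + 1 := ⟨m - 1, by omega⟩
  -- The witness is `x_0^(j+2) x_1 ⋯ x_j`. By the exponent bounds only the summand `p_2 · e_j[e_2]`
  -- reaches `x_0^(j+2)`.
  let S := Icc 1 j
  have h0 : 0 ∉ S := by simp [S]
  have hval : hook S (j + 2) 0 = j + 2 := by simp [hook_apply, h0]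
  have hone : coeff (hook S (j + 2)) (plethysm (esymm (j + 1)) (hsymm 2)) = 1 := by
    rw [plethysm_esymm_hsymm_two, map_sum, sum_eq_single (j, 1)]
    · have he1 : expand 2 two_ne_zero (esymm 1) = psum 2 := by
        have e1 := newton_esymm 0
        simp only [zero_add, range_one, sum_singleton, Nat.cast_one, one_smul, pow_zero,
          Nat.sub_self, esymm_zero, mul_one] at e1
        rw [e1, expand_psum]
      dsimp only
      rw [he1, mul_comm, coeff_psum_mul two_ne_zero, sum_eq_single 0]
      · have : hook S (j + 2) - Finsupp.single 0 2 = hook S j := by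
          rw [hook, hook, Finsupp.single_add, add_right_comm, add_tsub_cancel_right]
        rw [this]
        exact coeff_hook_plethysm_esymm_esymm_two j h0 (by simp [S])
      · intro i hi hi0
        have h2 := (mem_filter.1 hi).2
        rw [hook_apply, if_neg hi0] at h2
        split_ifs at h2 <;> omega
      · intro h
        refine absurd (mem_filter.2 ⟨?_, ?_⟩) h
        · rw [Finsupp.mem_support_iff, hval]
          omega
        · rw [hval]
          omega
    · rintro ⟨i, k⟩ hik hne
      rw [HasAntidiagonal.mem_antidiagonal] at hik
      by_contra hc
      have hle := expLE_plethysm_esymm_mul i k _ hc 0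
      rw [hval] at hle
      have hk : k ≠ 1 := by
        rintro rfl
        exact hne (Prod.ext (by simpa using hik) rfl)
      dsimp only at hik
      split_ifs at hle <;> omega
    · simp
  exact ⟨_, by rw [hone]; exact one_ne_zero, hval⟩

lemma sharplyBoundedBy_plethysm_esymm_hsymm_two {m : ℕ} (hm : 1 ≤ m) :
    SharplyBoundedBy (plethysm (esymm m) (hsymm 2)) (m + 1) := by
  obtain ⟨a, ha, h0⟩ := exists_coeff_plethysm_esymm_hsymm_two_ne_zero hm
  exact sharplyBoundedBy_of_expLE (plethysm_esymm_mem_Lam (hsymm_mem_Lam 2) m)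
    (expLE_plethysm_esymm_hsymm_two m) ha h0

open Equiv

/-! ### The Frobenius characteristic -/

/-- The cycle type of a permutation of `Fin n`, as a partition of `n`. -/
def cyclePartition {n : ℕ} (w : Perm (Fin n)) : n.Partition :=
  ⟨w.partition.parts, fun {_} hi => w.partition.parts_pos hi,
    w.partition.parts_sum.trans (Fintype.card_fin n)⟩

lemma cyclePartition_eq_iff {n : ℕ} {w v : Perm (Fin n)} :
    cyclePartition w = cyclePartition v ↔ IsConj w v := by
  rw [Perm.partition_eq_of_isConj, Nat.Partition.ext_iff, Nat.Partition.ext_iff]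
  rfl

/-- `cycleType` omits fixed points, so the parts equal to 1 are split off and recovered from the
size. -/
lemma cyclePartition_surjective {n : ℕ} : Function.Surjective (@cyclePartition n) := by
  intro lam
  have hsplit : lam.parts = lam.parts.filter (2 ≤ ·) +
      Multiset.replicate (lam.parts.filter fun p => ¬ 2 ≤ p).card 1 := by
    conv_lhs => rw [← Multiset.filter_add_not (2 ≤ ·) lam.parts]
    congr 1
    refine Multiset.eq_replicate_card.2 fun p hp => ?_
    have h1 := (Multiset.mem_filter.1 hp).2
    have h2 := lam.parts_pos (Multiset.mem_filter.1 hp).1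
    omega
  have hsum := congrArg Multiset.sum hsplit
  rw [lam.parts_sum, Multiset.sum_add, Multiset.sum_replicate, smul_eq_mul, mul_one] at hsum
  obtain ⟨w, hw⟩ := (Perm.exists_with_cycleType_iff (Fin n) (m := lam.parts.filter (2 ≤ ·))).2
    ⟨by rw [Fintype.card_fin]; omega, fun a ha => (Multiset.mem_filter.1 ha).2⟩
  refine ⟨w, Nat.Partition.ext ?_⟩
  change w.partition.parts = _
  rw [Perm.parts_partition, ← Perm.sum_cycleType, hw, Fintype.card_fin]
  conv_rhs => rw [hsplit]
  congr 2
  omega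

lemma classFun_apply_eq {n : ℕ} (f : ClassFun (Perm (Fin n))) {w v : Perm (Fin n)}
    (h : cyclePartition w = cyclePartition v) : f.1 w = f.1 v := by
  obtain ⟨g, rfl⟩ := isConj_iff.1 (cyclePartition_eq_iff.1 h)
  exact (f.2 g w).symm

lemma ch_eq {n : ℕ} (f : ClassFun (Perm (Fin n))) :
    ch f = (n.factorial : ℂ)⁻¹ • ∑ w, f.1 w • psumProd (cyclePartition w).parts := rfl

lemma ch_add {n : ℕ} (f g : ClassFun (Perm (Fin n))) : ch (f + g) = ch f + ch g := by
  simp only [ch_eq, Submodule.coe_add, Pi.add_apply, add_smul, sum_add_distrib, smul_add]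

lemma ch_smul {n : ℕ} (c : ℂ) (f : ClassFun (Perm (Fin n))) : ch (c • f) = c • ch f := by
  simp only [ch_eq, Submodule.coe_smul, Pi.smul_apply, smul_eq_mul, mul_smul, ← smul_sum]
  rw [smul_comm]

/-- The Frobenius characteristic as a linear map. -/
def chHom (n : ℕ) : ClassFun (Perm (Fin n)) →ₗ[ℂ] MvPowerSeries ℕ ℂ where
  toFun := ch
  map_add' := ch_add
  map_smul' := ch_smul

lemma ch_sum_smul {n : ℕ} {ι : Type*} (s : Finset ι) (c : ι → ℂ)
    (f : ι → ClassFun (Perm (Fin n))) :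
    ch (∑ i ∈ s, c i • f i) = ∑ i ∈ s, c i • ch (f i) := by
  change chHom n _ = ∑ i ∈ s, c i • chHom n (f i)
  simp only [map_sum, map_smul]

lemma ch_sum {n : ℕ} {ι : Type*} (s : Finset ι) (f : ι → ClassFun (Perm (Fin n))) :
    ch (∑ i ∈ s, f i) = ∑ i ∈ s, ch (f i) :=
  map_sum (chHom n) _ _

lemma ch_mem_Lam {n : ℕ} (f : ClassFun (Perm (Fin n))) : ch f ∈ Lam n := by
  rw [ch_eq]
  exact Submodule.smul_mem _ _ (Submodule.sum_mem _ fun w _ => Submodule.smul_mem _ _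
    (Submodule.subset_span ⟨_, rfl⟩))

lemma linearIndependent_psumProd_degree (n : ℕ) :
    LinearIndependent ℂ fun lam : n.Partition => psumProd lam.parts :=
  linearIndependent_psumProd.comp (fun lam : n.Partition => (⟨n, lam⟩ : Σ n : ℕ, n.Partition))
    sigma_mk_injective

lemma ch_eq_sum_partition {n : ℕ} (f : ClassFun (Perm (Fin n))) :
    ch f = ∑ lam : n.Partition, ((n.factorial : ℂ)⁻¹ *
      ∑ w with cyclePartition w = lam, f.1 w) • psumProd lam.parts := by
  rw [ch_eq, ← sum_fiberwise univ cyclePartition, smul_sum]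
  refine sum_congr rfl fun lam _ => ?_
  rw [mul_smul, sum_smul]
  congr 1
  exact sum_congr rfl fun w hw => by rw [(mem_filter.1 hw).2]

lemma factorial_inv_ne_zero (n : ℕ) : (n.factorial : ℂ)⁻¹ ≠ 0 :=
  inv_ne_zero (Nat.cast_ne_zero.2 n.factorial_ne_zero)

lemma sum_class {n : ℕ} (f : ClassFun (Perm (Fin n))) (v : Perm (Fin n)) :
    ∑ w with cyclePartition w = cyclePartition v, f.1 w =
      (#{w : Perm (Fin n) | cyclePartition w = cyclePartition v} : ℂ) * f.1 v := by
  rw [sum_congr rfl fun w hw => classFun_apply_eq f (mem_filter.1 hw).2, sum_const, nsmul_eq_mul]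

lemma card_class_ne_zero {n : ℕ} (v : Perm (Fin n)) :
    (#{w : Perm (Fin n) | cyclePartition w = cyclePartition v} : ℂ) ≠ 0 :=
  Nat.cast_ne_zero.2 (card_ne_zero.2 ⟨v, by simp⟩)

/-- The coefficient of `p_λ` in `ch f` is the value of `f` on the class `λ` times a nonzero factor,
the class size over `n!`. -/
lemma ch_injective (n : ℕ) : Function.Injective (@ch n) := by
  change Function.Injective (chHom n)
  rw [injective_iff_map_eq_zero]
  intro f hf
  change ch f = 0 at hf
  rw [ch_eq_sum_partition] at hf
  refine Subtype.ext (funext fun v => ?_)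
  have h := Fintype.linearIndependent_iff.1 (linearIndependent_psumProd_degree n) _ hf
    (cyclePartition v)
  have h1 := (mul_eq_zero.1 h).resolve_left (factorial_inv_ne_zero n)
  rw [sum_class] at h1
  exact (mul_eq_zero.1 h1).resolve_left (card_class_ne_zero v)

lemma exists_ch_eq {n : ℕ} {F : MvPowerSeries ℕ ℂ} (hF : F ∈ Lam n) : ∃ f, @ch n f = F := by
  have hle : Lam n ≤ LinearMap.range (chHom n) := by
    refine Submodule.span_le.2 ?_
    rintro _ ⟨lam, rfl⟩
    obtain ⟨v, rfl⟩ := cyclePartition_surjective lam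
    let f : ClassFun (Perm (Fin n)) :=
      ⟨fun w => if cyclePartition w = cyclePartition v then 1 else 0, fun g w => by
        have : cyclePartition (g * w * g⁻¹) = cyclePartition w :=
          cyclePartition_eq_iff.2 (isConj_iff.2 ⟨g, rfl⟩).symm
        simp only [this]⟩
    have hf : ch f = ((n.factorial : ℂ)⁻¹ *
        #{w : Perm (Fin n) | cyclePartition w = cyclePartition v}) •
          psumProd (cyclePartition v).parts := by
      rw [ch_eq_sum_partition, sum_eq_single (cyclePartition v)]
      · rw [sum_class]
        simp [f]
      · intro mu _ hmu
        rw [sum_eq_zero fun w hw => ?_, mul_zero, zero_smul]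
        exact if_neg fun h => hmu ((mem_filter.1 hw).2.symm.trans h)
      · simp
    have hmem : ch f ∈ LinearMap.range (chHom n) := ⟨f, rfl⟩
    rw [hf] at hmem
    exact (Submodule.smul_mem_iff _ (mul_ne_zero (factorial_inv_ne_zero n)
      (card_class_ne_zero v))).1 hmem
  exact hle hF

lemma ch_chInv {n : ℕ} {F : MvPowerSeries ℕ ℂ} (hF : F ∈ Lam n) : ch (chInv n F) = F :=
  Function.invFun_eq (exists_ch_eq hF)

lemma ch_irrChar {n : ℕ} (lam : n.Partition) : ch (irrChar lam) = schur lam :=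
  ch_chInv (schur_mem_Lam lam)

lemma isIrrExpansion_of_ch_eq {n : ℕ} {χ : ClassFun (Perm (Fin n))} {c : n.Partition → ℂ}
    (h : ∑ lam, c lam • schur lam = ch χ) : IsIrrExpansion χ c := fun c' => by
  rw [← (ch_injective n).eq_iff, ch_sum_smul, ← h]
  simp only [ch_irrChar]
  exact ⟨sum_schur_injective, fun h => by rw [h]⟩

lemma exists_isIrrExpansion {n : ℕ} (χ : ClassFun (Perm (Fin n))) :
    ∃ c, IsIrrExpansion χ c ∧ ∑ lam, c lam • schur lam = ch χ := by
  obtain ⟨c, hc⟩ := exists_sum_schur (ch_mem_Lam χ)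
  exact ⟨c, isIrrExpansion_of_ch_eq hc, hc⟩

lemma charBoundedBy_of_expLE {n N : ℕ} {χ : ClassFun (Perm (Fin n))} (h : ExpLE (ch χ) N) :
    CharBoundedBy χ N := by
  obtain ⟨c, hc, hs⟩ := exists_isIrrExpansion χ
  exact ⟨c, hc, fun lam hlam => firstPart_le_of_expLE_sum (hs ▸ h) hlam⟩

/-! ### Exponent bounds for `ℓ_n` and `π_n` -/

lemma coeff_single_psumProd (i : ℕ) (s : Multiset ℕ) (hs : ∀ k ∈ s, 0 < k) :
    coeff (Finsupp.single i s.sum) (psumProd s) = 1 := by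
  induction s using Multiset.induction_on with
  | empty => simp [psumProd]
  | cons k s ih =>
    have hk : 0 < k := hs k (Multiset.mem_cons_self k s)
    have h1 : psumProd (k ::ₘ s) = psum k * psumProd s := by simp [psumProd]
    have h2 : {j ∈ (Finsupp.single i (k + s.sum)).support | k ≤ Finsupp.single i (k + s.sum) j} =
        {i} := by
      rw [Finsupp.support_single i (show k + s.sum ≠ 0 by omega)]
      ext j
      simp only [mem_filter, mem_singleton, and_iff_left_iff_imp]
      rintro rfl
      simp
    rw [h1, Multiset.sum_cons, coeff_psum_mul hk.ne', h2, sum_singleton, Finsupp.single_add,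
      add_tsub_cancel_left]
    exact ih fun j hj => hs j (Multiset.mem_cons_of_mem hj)

/-- The monomial `x_i^n` has coefficient 1 in every `p_λ`, so its coefficient in `ch f` is the mean
of `f`. -/
lemma coeff_single_ch {n : ℕ} (i : ℕ) (f : ClassFun (Perm (Fin n))) :
    coeff (Finsupp.single i n) (ch f) = (n.factorial : ℂ)⁻¹ * ∑ w, f.1 w := by
  rw [ch_eq, coeff_smul, map_sum]
  congr 1
  refine sum_congr rfl fun w _ => ?_
  have h := coeff_single_psumProd i (cyclePartition w).parts
    fun k hk => (cyclePartition w).parts_pos hk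
  rw [(cyclePartition w).parts_sum] at h
  rw [coeff_smul, h, mul_one]

/-- In degree `n` an exponent of at least `n` leaves only the monomial `x_i^n`, whose coefficient is
the mean of `f`. -/
lemma expLE_of_sum_eq_zero {n : ℕ} {f : ClassFun (Perm (Fin n))} (h : ∑ w, f.1 w = 0) :
    ExpLE (ch f) (n - 1) := fun a ha i => by
  by_contra! hi
  have hdeg := degree_eq_of_mem_Lam (ch_mem_Lam f) ha
  have hle : n ≤ a i := by omega
  have h1 := degree_sub_single hle
  rw [hdeg, Nat.add_eq_right, Finsupp.degree_eq_zero_iff] at h1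
  have h2 : a = Finsupp.single i n :=
    le_antisymm (tsub_eq_zero_iff_le.1 h1) (Finsupp.single_le_iff.2 hle)
  rw [h2, coeff_single_ch, h, mul_zero] at ha
  exact ha rfl

/-- Frobenius reciprocity against a conjugation invariant function `e`: each `x` in the induction
formula gives the same sum over `H`. -/
lemma sum_mul_induce {G : Type} [Group G] [Fintype G] (H : Subgroup G) [Fintype H]
    (f : ClassFun H) {e : G → ℂ} (he : ∀ x w, e (x⁻¹ * w * x) = e w) :
    ∑ w, e w * (induce H f).1 w =
      (Nat.card H : ℂ)⁻¹ * (Fintype.card G * ∑ h : H, e h * f.1 h) := by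
  classical
  have hH : ∑ h : H, e h * f.1 h = ∑ w : G, if hw : w ∈ H then e w * f.1 ⟨w, hw⟩ else 0 := by
    refine sum_of_injOn Subtype.val Subtype.val_injective.injOn (fun _ _ => mem_coe.2 (mem_univ _))
      (fun w _ hw => dif_neg fun h => hw ⟨⟨w, h⟩, by simp, rfl⟩) fun h _ => ?_
    rw [dif_pos h.2]
  have hx : ∀ x : G, ∑ w, e w * (if hx : x⁻¹ * w * x ∈ H then f.1 ⟨x⁻¹ * w * x, hx⟩ else 0) =
      ∑ h : H, e h * f.1 h := by
    intro x
    rw [hH]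
    refine Fintype.sum_equiv (MulAut.conj x⁻¹).toEquiv _ _ fun w => ?_
    have hval : (MulAut.conj x⁻¹).toEquiv w = x⁻¹ * w * x := by simp
    have key : ∀ y z : G, y = z → e w = e z →
        (e w * if hy : y ∈ H then f.1 ⟨y, hy⟩ else 0) =
          if hz : z ∈ H then e z * f.1 ⟨z, hz⟩ else 0 := by
      rintro y _ rfl h
      rw [h]
      split_ifs <;> simp
    exact key _ _ hval.symm (by rw [hval, he])
  simp only [induce, mul_left_comm (e _), ← mul_sum]
  congr 1
  simp only [mul_sum]
  rw [sum_comm]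
  simp only [hx, sum_const, card_univ, nsmul_eq_mul, mul_sum]

lemma cyclicHom_gen (n : ℕ) :
    cyclicHom n ⟨finRotate n, Subgroup.mem_zpowers _⟩ = rootUnit n :=
  monoidHomOfForallMemZpowers_apply_gen _ _

/-- By reciprocity this is a multiple of the sum of a linear character over the cyclic group, and
the hypothesis says that this character is nontrivial. It is used for `e` trivial and for `e` the
sign. -/
lemma sum_mul_lieCyc_eq_zero {n : ℕ} {e : Perm (Fin n) →* ℂ}
    (he : e (finRotate n) * (rootUnit n : ℂ) ≠ 1) : ∑ w, e w * (lieCyc n).1 w = 0 := by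
  classical
  rw [lieCyc, sum_mul_induce _ _ fun x w => ?_]
  · let ψ : Subgroup.zpowers (finRotate n) →* ℂ :=
      e.comp (Subgroup.subtype _) * (Units.coeHom ℂ).comp (cyclicHom n)
    have hψ : ψ ≠ 1 := fun h => he (by
      have h1 := DFunLike.congr_fun h ⟨finRotate n, Subgroup.mem_zpowers _⟩
      rw [← cyclicHom_gen]
      exact h1)
    have hsum : ∑ h : Subgroup.zpowers (finRotate n), e h * (linChar (cyclicHom n)).1 h = 0 :=
      sum_hom_units_eq_zero ψ hψ
    rw [hsum, mul_zero, mul_zero]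
  · rw [map_mul, map_mul, mul_right_comm, ← map_mul, inv_mul_cancel, map_one, one_mul]

lemma isPrimitiveRoot_rootUnit {n : ℕ} (hn : n ≠ 0) : IsPrimitiveRoot (rootUnit n : ℂ) n :=
  Complex.isPrimitiveRoot_exp n hn

lemma sum_lieCyc_eq_zero {n : ℕ} (hn : 2 ≤ n) : ∑ w, (lieCyc n).1 w = 0 := by
  have := sum_mul_lieCyc_eq_zero (n := n) (e := 1) (by
    rw [MonoidHom.one_apply, one_mul]
    exact (isPrimitiveRoot_rootUnit (by omega)).ne_one (by omega))
  simpa using this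

/-- If sign times `ζ` were 1 on the `n`-cycle, then `ζ² = 1` and `n ∣ 2`. For `n = 2` this does
happen, which is why `π_2 = h_2` is exceptional. -/
lemma sum_signTwist_lieCyc_eq_zero {n : ℕ} (hn : 3 ≤ n) :
    ∑ w, (signTwist (lieCyc n)).1 w = 0 := by
  let e : Perm (Fin n) →* ℂ :=
    ((Int.castRingHom ℂ : ℤ →* ℂ).comp (Units.coeHom ℤ)).comp Perm.sign
  refine sum_mul_lieCyc_eq_zero (e := e) fun h => ?_
  have hroot := isPrimitiveRoot_rootUnit (n := n) (by omega)
  have he : e (finRotate n) ^ 2 = 1 := by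
    rw [← map_pow]
    change (((Perm.sign (finRotate n ^ 2) : ℤˣ) : ℤ) : ℂ) = 1
    rw [map_pow, Int.units_sq]
    simp
  have h2 : (rootUnit n : ℂ) ^ 2 = 1 := by
    have := congrArg (· ^ 2) h
    simpa [mul_pow, he] using this
  have := Nat.le_of_dvd two_pos ((hroot.pow_eq_one_iff_dvd 2).1 h2)
  omega

lemma expLE_ell {n : ℕ} (hn : 2 ≤ n) : ExpLE (ell n) (n - 1) :=
  expLE_of_sum_eq_zero (sum_lieCyc_eq_zero hn)

lemma expLE_piSymm {n : ℕ} (hn : 3 ≤ n) : ExpLE (piSymm n) (n - 1) :=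
  expLE_of_sum_eq_zero (sum_signTwist_lieCyc_eq_zero hn)

lemma ell_mem_Lam (n : ℕ) : ell n ∈ Lam n := ch_mem_Lam _

lemma piSymm_mem_Lam (n : ℕ) : piSymm n ∈ Lam n := ch_mem_Lam _

/-! ### The case `n = 2` -/

lemma univ_perm_two : (univ : Finset (Perm (Fin 2))) = {1, finRotate 2} := by decide

lemma one_ne_finRotate_two : (1 : Perm (Fin 2)) ≠ finRotate 2 := by decide

lemma ch_two (f : ClassFun (Perm (Fin 2))) :
    ch f = (2 : ℂ)⁻¹ • (f.1 1 • (psum 1 * psum 1) + f.1 (finRotate 2) • psum 2) := by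
  have h1 : (Perm.partition (1 : Perm (Fin 2))).parts = {1, 1} := by
    rw [Perm.parts_partition]
    simp [Multiset.replicate_succ]
  have h2 : (Perm.partition (finRotate 2)).parts = {2} := by
    rw [Perm.parts_partition, cycleType_finRotate, support_finRotate]
    simp
  rw [ch, univ_perm_two, sum_pair one_ne_finRotate_two, h1, h2]
  simp

lemma induce_one {G : Type} [Group G] [Fintype G] (H : Subgroup G) (f : ClassFun H) :
    (induce H f).1 1 = (Nat.card H : ℂ)⁻¹ * (Fintype.card G * f.1 1) := by
  classical
  have hone : ∀ y : G, y = 1 → (if hy : y ∈ H then f.1 ⟨y, hy⟩ else 0) = f.1 1 := by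
    rintro _ rfl
    exact dif_pos (one_mem H)
  simp only [induce, fun x : G => hone (x⁻¹ * 1 * x) (by simp), sum_const, card_univ, nsmul_eq_mul]

lemma lieCyc_two_one : (lieCyc 2).1 1 = 1 := by
  have h : Nat.card (Subgroup.zpowers (finRotate 2)) = 2 := by
    rw [Nat.card_zpowers, isCycle_finRotate.orderOf, support_finRotate]
    simp
  rw [lieCyc, induce_one, h]
  simp [linChar, Fintype.card_perm]

lemma lieCyc_two_finRotate : (lieCyc 2).1 (finRotate 2) = -1 := by
  have h := sum_lieCyc_eq_zero le_rfl
  rw [univ_perm_two, sum_pair one_ne_finRotate_two, lieCyc_two_one] at h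
  linear_combination h

lemma two_smul_esymm_two : (2 : ℂ) • esymm 2 = psum 1 * psum 1 - psum 2 := by
  have e1 := newton_esymm 0
  have e2 := newton_esymm 1
  simp only [sum_range_succ, range_zero, sum_empty, zero_add, Nat.sub_self,
    esymm_zero, Nat.cast_one, one_smul, pow_zero, pow_one, mul_one, Nat.sub_zero,
    neg_smul] at e1 e2
  norm_num at e1 e2
  rw [e2, e1, sub_eq_add_neg]

lemma ell_two : ell 2 = esymm 2 := by
  have h : ell 2 = (2 : ℂ)⁻¹ • ((2 : ℂ) • esymm 2) := by
    rw [two_smul_esymm_two, ell, ch_two, lieCyc_two_one, lieCyc_two_finRotate, one_smul, neg_smul,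
      one_smul, sub_eq_add_neg]
  rw [h, inv_smul_smul₀ two_ne_zero]

lemma piSymm_two : piSymm 2 = hsymm 2 := by
  have hs : (signTwist (lieCyc 2)).1 (finRotate 2) = 1 := by
    change ((Perm.sign (finRotate 2) : ℤ) : ℂ) * (lieCyc 2).1 (finRotate 2) = 1
    rw [lieCyc_two_finRotate, sign_finRotate]
    simp
  have h1 : (signTwist (lieCyc 2)).1 1 = 1 := by
    change ((Perm.sign (1 : Perm (Fin 2)) : ℤ) : ℂ) * (lieCyc 2).1 1 = 1
    rw [lieCyc_two_one]
    simp
  have h : piSymm 2 = (2 : ℂ)⁻¹ • ((2 : ℂ) • hsymm 2) := by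
    rw [hsymm_two, smul_add, two_smul_esymm_two, piSymm, ch_two, h1, hs, one_smul, one_smul,
      two_smul]
    congr 1
    ring
  rw [h, inv_smul_smul₀ two_ne_zero]

/-! ### The characters `Lie_λ` and `W_λ` -/

lemma sum_count_mul {n : ℕ} (lam : n.Partition) (g : ℕ → ℕ) :
    ∑ j ∈ Icc 1 n, lam.parts.count j * g j = (lam.parts.map g).sum := by
  rw [sum_multiset_map_count]
  symm
  refine sum_subset (fun j hj => ?_) fun j _ hj => ?_
  · rw [Multiset.mem_toFinset] at hj
    exact mem_Icc.2 ⟨lam.parts_pos hj, lam.le_of_mem_parts hj⟩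
  · rw [Multiset.mem_toFinset] at hj
    rw [Multiset.count_eq_zero_of_notMem hj, zero_smul]

lemma sum_count_mul_self {n : ℕ} (lam : n.Partition) :
    ∑ j ∈ Icc 1 n, lam.parts.count j * j = n := by
  rw [sum_count_mul lam fun j => j, Multiset.map_id', lam.parts_sum]

/-- The Frobenius characteristic of `Lie_λ`. -/
def lieSymm {n : ℕ} (lam : n.Partition) : MvPowerSeries ℕ ℂ :=
  ∏ j ∈ Icc 1 n, plethysm (hsymm (lam.parts.count j)) (ell j)

/-- The Frobenius characteristic of `W_λ`. -/
def whitneySymm {n : ℕ} (lam : n.Partition) : MvPowerSeries ℕ ℂ :=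
  ∏ j ∈ Icc 1 n, if Odd j then plethysm (hsymm (lam.parts.count j)) (piSymm j)
    else plethysm (esymm (lam.parts.count j)) (piSymm j)

lemma lieSymm_mem_Lam {n : ℕ} (lam : n.Partition) : lieSymm lam ∈ Lam n := by
  have h := prod_mem_Lam (s := Icc 1 n) fun j _ =>
    plethysm_hsymm_mem_Lam (ell_mem_Lam j) (lam.parts.count j)
  rwa [sum_count_mul_self] at h

lemma whitneySymm_mem_Lam {n : ℕ} (lam : n.Partition) : whitneySymm lam ∈ Lam n := by
  have h := prod_mem_Lam (s := Icc 1 n) (n := fun j => lam.parts.count j * j)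
    (f := fun j => if Odd j then plethysm (hsymm (lam.parts.count j)) (piSymm j)
      else plethysm (esymm (lam.parts.count j)) (piSymm j)) fun j _ => by
    split_ifs
    · exact plethysm_hsymm_mem_Lam (piSymm_mem_Lam j) _
    · exact plethysm_esymm_mem_Lam (piSymm_mem_Lam j) _
  rwa [sum_count_mul_self] at h

lemma ch_lieChar {n : ℕ} (lam : n.Partition) : ch (lieChar lam) = lieSymm lam :=
  ch_chInv (lieSymm_mem_Lam lam)

lemma ch_whitneyChar {n : ℕ} (lam : n.Partition) : ch (whitneyChar lam) = whitneySymm lam := by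
  have h : whitneyChar lam = chInv n (whitneySymm lam) := by
    rw [whitneyChar, whitneySymm, prod_ite]
    simp only [Nat.not_odd_iff_even]
  rw [h, ch_chInv (whitneySymm_mem_Lam lam)]

lemma expLE_lieSymm {n : ℕ} {lam : n.Partition} (h1 : 1 ∉ lam.parts) :
    ExpLE (lieSymm lam) (rank lam) := by
  rw [rank, ← sum_count_mul]
  refine ExpLE.prod fun j hj => ?_
  rw [mem_Icc] at hj
  by_cases hj1 : j = 1
  · subst hj1
    rw [Multiset.count_eq_zero_of_notMem h1, hsymm_zero, plethysm_one]
    exact ExpLE.one _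
  · exact expLE_plethysm_hsymm (expLE_ell (by omega)) _

lemma expLE_whitneySymm {n : ℕ} {lam : n.Partition} (h1 : 1 ∉ lam.parts) :
    ExpLE (whitneySymm lam) (rank lam + 1) := by
  have h := ExpLE.prod (s := Icc 1 n)
    -- Only the factor `e_m[h_2]` of the parts 2 can exceed its share of the rank, and by at most 1.
    (N := fun j => lam.parts.count j * (j - 1) + if j = 2 then 1 else 0)
    (f := fun j => if Odd j then plethysm (hsymm (lam.parts.count j)) (piSymm j)
      else plethysm (esymm (lam.parts.count j)) (piSymm j)) fun j hj => by
    rw [mem_Icc] at hj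
    by_cases hj1 : j = 1
    · subst hj1
      rw [Multiset.count_eq_zero_of_notMem h1, hsymm_zero, esymm_zero, plethysm_one, ite_self]
      exact ExpLE.one _
    · by_cases hj2 : j = 2
      · subst hj2
        rw [if_neg (by decide), if_pos rfl, piSymm_two, show 2 - 1 = 1 from rfl, mul_one]
        exact expLE_plethysm_esymm_hsymm_two _
      · rw [if_neg hj2, add_zero]
        split_ifs
        · exact expLE_plethysm_hsymm (expLE_piSymm (by omega)) _
        · exact expLE_plethysm_esymm (expLE_piSymm (by omega)) _
  refine h.mono ?_
  rw [sum_add_distrib, sum_count_mul lam fun j => j - 1, rank, sum_ite_eq']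
  split_ifs <;> simp

/-! ### Partitions of a given rank without parts of size one -/

lemma two_le_of_mem_parts {n : ℕ} {lam : n.Partition} (h1 : 1 ∉ lam.parts) {p : ℕ}
    (hp : p ∈ lam.parts) : 2 ≤ p := by
  have h0 := lam.parts_pos hp
  have : p ≠ 1 := fun h => h1 (h ▸ hp)
  omega

lemma two_mul_rank {n : ℕ} (lam : n.Partition) :
    2 * rank lam = (lam.parts.map fun p => 2 * (p - 1)).sum := by
  rw [rank, Multiset.sum_map_mul_left]

/-- Each part `p ≥ 2` satisfies `p ≤ 2 (p - 1)`, with equality only for `p = 2`; the equality case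
isolates `2^i` in `derangementTypes_two_mul`. -/
lemma le_two_mul_rank {n : ℕ} {lam : n.Partition} (h1 : 1 ∉ lam.parts) : n ≤ 2 * rank lam := by
  rw [two_mul_rank]
  calc n = (lam.parts.map fun p => p).sum := by rw [Multiset.map_id', lam.parts_sum]
    _ ≤ _ := Multiset.sum_map_le_sum_map _ _ fun p hp => by
      have := two_le_of_mem_parts h1 hp
      omega

/-- The partition `2^i`. -/
def twos (i : ℕ) : (2 * i).Partition :=
  ⟨Multiset.replicate i 2, fun {p} hp => by rw [Multiset.eq_of_mem_replicate hp]; exact two_pos, by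
    rw [Multiset.sum_replicate, smul_eq_mul, mul_comm]⟩

lemma derangementTypes_two_mul (i : ℕ) : derangementTypes i (2 * i) = {twos i} := by
  ext lam
  rw [derangementTypes, mem_filter, mem_singleton]
  constructor
  · rintro ⟨-, h1, hr⟩
    have hall : ∀ p ∈ lam.parts, p = 2 := by
      by_contra! h
      obtain ⟨q, hq, hq2⟩ := h
      have hlt : (lam.parts.map fun p => p).sum < (lam.parts.map fun p => 2 * (p - 1)).sum :=
        Multiset.sum_lt_sum (fun p hp => by
          have := two_le_of_mem_parts h1 hp
          omega) ⟨q, hq, by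
          have := two_le_of_mem_parts h1 hq
          omega⟩
      rw [Multiset.map_id', lam.parts_sum, ← two_mul_rank, hr] at hlt
      exact lt_irrefl _ hlt
    have hrep := Multiset.eq_replicate_card.2 hall
    have hsum := lam.parts_sum
    rw [hrep, Multiset.sum_replicate, smul_eq_mul] at hsum
    refine Nat.Partition.ext (hrep.trans ?_)
    rw [show lam.parts.card = i by omega]
    rfl
  · rintro rfl
    refine ⟨mem_univ _, fun h => ?_, ?_⟩
    · have := Multiset.eq_of_mem_replicate h
      omega
    · simp [rank, twos]

lemma derangementTypes_eq_empty {i n : ℕ} (h : 2 * i < n) : derangementTypes i n = ∅ := by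
  refine filter_eq_empty_iff.2 fun lam _ hlam => ?_
  have := le_two_mul_rank hlam.1
  omega

lemma count_twos (i j : ℕ) : (twos i).parts.count j = if j = 2 then i else 0 := by
  rw [twos, Multiset.count_replicate]
  simp only [eq_comm]

lemma lieSymm_twos (i : ℕ) : lieSymm (twos i) = plethysm (hsymm i) (esymm 2) := by
  rw [lieSymm, prod_eq_single 2]
  · rw [count_twos, if_pos rfl, ell_two]
  · intro j _ hj
    rw [count_twos, if_neg hj, hsymm_zero, plethysm_one]
  · intro h
    have : i = 0 := by
      rw [mem_Icc] at h
      omega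
    rw [count_twos, if_pos rfl, this, hsymm_zero, plethysm_one]

lemma whitneySymm_twos (i : ℕ) : whitneySymm (twos i) = plethysm (esymm i) (hsymm 2) := by
  rw [whitneySymm, prod_eq_single 2]
  · rw [if_neg (by decide), count_twos, if_pos rfl, piSymm_two]
  · intro j _ hj
    rw [count_twos, if_neg hj, hsymm_zero, esymm_zero, plethysm_one, ite_self]
  · intro h
    have : i = 0 := by
      rw [mem_Icc] at h
      omega
    rw [if_neg (by decide), count_twos, if_pos rfl, this, esymm_zero, plethysm_one]

/-- Bounds for a family of class functions, one for each size, that vanishes in sizes above `2 i`;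
the last assertion holds if an exponent `N` occurs in size `2 i`. -/
lemma exists_expansions {χ : (n : ℕ) → ClassFun (Perm (Fin n))} {i N : ℕ}
    (hexp : ∀ n, ExpLE (ch (χ n)) N) (hzero : ∀ n, 2 * i < n → χ n = 0) :
    ∃ c : (n : ℕ) → n.Partition → ℂ, (∀ n, IsIrrExpansion (χ n) (c n)) ∧
      (∀ (n : ℕ) (mu : n.Partition), c n mu ≠ 0 → firstPart mu ≤ N) ∧
      ((∃ a : ℕ →₀ ℕ, coeff a (ch (χ (2 * i))) ≠ 0 ∧ a 0 = N) →
        IsGreatest (stabSet c) (2 * i + N)) := by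
  choose c hc hs using fun n => exists_isIrrExpansion (χ n)
  have hfirst : ∀ (n : ℕ) (mu : n.Partition), c n mu ≠ 0 → firstPart mu ≤ N := fun n mu hmu =>
    firstPart_le_of_expLE_sum (hs n ▸ hexp n) hmu
  refine ⟨c, hc, hfirst, ?_⟩
  rintro ⟨a, ha, ha0⟩
  constructor
  · rw [← hs, map_sum] at ha
    obtain ⟨mu, -, hmu⟩ := exists_ne_zero_of_sum_ne_zero ha
    rw [coeff_smul] at hmu
    have hne := left_ne_zero_of_mul hmu
    -- A Schur function containing the monomial with `x_0`-exponent `N` has first part at least `N`,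
    -- hence exactly `N`.
    have hle := expLE_schur mu a (right_ne_zero_of_mul hmu) 0
    exact ⟨2 * i, mu, hne, by rw [le_antisymm (hfirst _ mu hne) (ha0 ▸ hle)]⟩
  · rintro k ⟨n, mu, hmu, rfl⟩
    refine add_le_add ?_ (hfirst n mu hmu)
    by_contra! hn
    refine hmu (congrFun (sum_schur_injective (c' := 0) ?_) mu)
    rw [hs, hzero n hn]
    simp [ch_eq]

lemma expLE_ch_lieHat (i n : ℕ) : ExpLE (ch (lieHat i n)) i := by
  rw [lieHat, ch_sum]
  refine ExpLE.sum fun lam hlam => ?_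
  have h := (mem_filter.1 hlam).2
  rw [ch_lieChar, ← h.2]
  exact expLE_lieSymm h.1

lemma expLE_ch_whitneyHat (i n : ℕ) : ExpLE (ch (whitneyHat i n)) (i + 1) := by
  rw [whitneyHat, ch_sum]
  refine ExpLE.sum fun lam hlam => ?_
  have h := (mem_filter.1 hlam).2
  rw [ch_whitneyChar, ← h.2]
  exact expLE_whitneySymm h.1

end SymmFun

end

/-! ### Assembly of the assertions. -/

theorem theorem3 :
    -- (a)
    (∀ m n : ℕ, 1 ≤ m → 3 ≤ n →
      SymmFun.BoundedBy (SymmFun.plethysm (SymmFun.hsymm m) (SymmFun.ell n)) (m * (n - 1)) ∧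
      SymmFun.BoundedBy (SymmFun.plethysm (SymmFun.hsymm m) (SymmFun.piSymm n)) (m * (n - 1)) ∧
      SymmFun.BoundedBy (SymmFun.plethysm (SymmFun.esymm m) (SymmFun.ell n)) (m * (n - 1)) ∧
      SymmFun.BoundedBy (SymmFun.plethysm (SymmFun.esymm m) (SymmFun.piSymm n)) (m * (n - 1))) ∧
    -- (b)
    (∀ m : ℕ, 1 ≤ m →
      SymmFun.SharplyBoundedBy (SymmFun.plethysm (SymmFun.hsymm m) (SymmFun.ell 2)) m) ∧
    -- (c)
    (∀ m : ℕ, 1 ≤ m →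
      SymmFun.SharplyBoundedBy (SymmFun.plethysm (SymmFun.esymm m) (SymmFun.piSymm 2)) (m + 1)) ∧
    -- (d)
    (∀ (i n : ℕ) (lam : n.Partition), 1 ∉ lam.parts → SymmFun.rank lam = i →
      SymmFun.CharBoundedBy (SymmFun.lieChar lam) i ∧
      SymmFun.CharBoundedBy (SymmFun.whitneyChar lam) (i + 1)) ∧
    -- (e), together with the resulting bounds for the sums
    (∀ i : ℕ, ∃ c : (n : ℕ) → n.Partition → ℂ,
      (∀ n, SymmFun.IsIrrExpansion (SymmFun.lieHat i n) (c n)) ∧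
      (∀ (n : ℕ) (mu : n.Partition), c n mu ≠ 0 → SymmFun.firstPart mu ≤ i) ∧
      IsGreatest (SymmFun.stabSet c) (3 * i)) ∧
    (∀ i : ℕ, ∃ c : (n : ℕ) → n.Partition → ℂ,
      (∀ n, SymmFun.IsIrrExpansion (SymmFun.whitneyHat i n) (c n)) ∧
      (∀ (n : ℕ) (mu : n.Partition), c n mu ≠ 0 → SymmFun.firstPart mu ≤ i + 1) ∧
      (1 ≤ i → IsGreatest (SymmFun.stabSet c) (3 * i + 1))) := by

  refine ⟨fun m n _ hn => ?_, fun m _ => ?_, fun m hm => ?_, fun i n lam h1 hr => ?_, fun i => ?_,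
    fun i => ?_⟩
  · have hl := SymmFun.expLE_ell (n := n) (by omega)
    have hp := SymmFun.expLE_piSymm hn
    have ml := SymmFun.ell_mem_Lam n
    have mp := SymmFun.piSymm_mem_Lam n
    exact ⟨SymmFun.boundedBy_of_expLE (SymmFun.plethysm_hsymm_mem_Lam ml m)
        (SymmFun.expLE_plethysm_hsymm hl m),
      SymmFun.boundedBy_of_expLE (SymmFun.plethysm_hsymm_mem_Lam mp m)
        (SymmFun.expLE_plethysm_hsymm hp m),
      SymmFun.boundedBy_of_expLE (SymmFun.plethysm_esymm_mem_Lam ml m)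
        (SymmFun.expLE_plethysm_esymm hl m),
      SymmFun.boundedBy_of_expLE (SymmFun.plethysm_esymm_mem_Lam mp m)
        (SymmFun.expLE_plethysm_esymm hp m)⟩
  · rw [SymmFun.ell_two]
    exact SymmFun.sharplyBoundedBy_plethysm_hsymm_esymm_two m
  · rw [SymmFun.piSymm_two]
    exact SymmFun.sharplyBoundedBy_plethysm_esymm_hsymm_two hm
  · subst hr
    constructor
    · refine SymmFun.charBoundedBy_of_expLE ?_
      rw [SymmFun.ch_lieChar]
      exact SymmFun.expLE_lieSymm h1
    · refine SymmFun.charBoundedBy_of_expLE ?_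
      rw [SymmFun.ch_whitneyChar]
      exact SymmFun.expLE_whitneySymm h1
  · obtain ⟨c, hc, hfirst, hgreatest⟩ := SymmFun.exists_expansions (χ := SymmFun.lieHat i)
      (SymmFun.expLE_ch_lieHat i) fun n hn => by
        rw [SymmFun.lieHat, SymmFun.derangementTypes_eq_empty hn, Finset.sum_empty]
    refine ⟨c, hc, hfirst, ?_⟩
    -- The maximal size `2 * i` and the maximal first part `i` are attained together, by a
    -- constituent of `Lie_λ` for `λ = 2^i`.
    rw [show 3 * i = 2 * i + i by omega]
    refine hgreatest ⟨Finsupp.single 0 i + Finsupp.single 1 i, ?_, by simp⟩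
    rw [SymmFun.lieHat, SymmFun.derangementTypes_two_mul, Finset.sum_singleton,
      SymmFun.ch_lieChar, SymmFun.lieSymm_twos]
    exact SymmFun.coeff_plethysm_hsymm_esymm_two_ne_zero i
  · obtain ⟨c, hc, hfirst, hgreatest⟩ := SymmFun.exists_expansions (χ := SymmFun.whitneyHat i)
      (SymmFun.expLE_ch_whitneyHat i) fun n hn => by
        rw [SymmFun.whitneyHat, SymmFun.derangementTypes_eq_empty hn, Finset.sum_empty]
    refine ⟨c, hc, hfirst, fun hi => ?_⟩
    rw [show 3 * i + 1 = 2 * i + (i + 1) by omega]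
    refine hgreatest ?_
    rw [SymmFun.whitneyHat, SymmFun.derangementTypes_two_mul, Finset.sum_singleton,
      SymmFun.ch_whitneyChar, SymmFun.whitneySymm_twos]
    exact SymmFun.exists_coeff_plethysm_esymm_hsymm_two_ne_zero hi
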